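/- Let $M$ be a smooth manifold of dimension $N\ge 2$ with a smooth Riemannian metric $a_{ij}(x)$ and a smooth 1-form $b_i(x)$ of unit length, $a^{ij}b_ib_j=1$. In local coordinates $(x^i,y^i)$ of $TM$ put $b=b_iy^i$, $b^i=a^{ij}b_j$, $r_{ij}=a_{ij}-b_ib_j$, $r^i_j=a^{im}r_{mj}$, $q=\sqrt{r_{ij}y^iy^j}$, $v^i=y^i-bb^i$, $v_i=a_{ij}y^j-bb_i$, $\eta^i_j=r^i_j-v^iv_j/q^2$, $\eta_{ij}=r_{ij}-v_iv_j/q^2$; let $a^i_{km}$ be the Christoffel symbols and $\nabla$ the covariant derivative of $a_{ij}$. Let $g$ be a constant with $-2<g<2$, $h=\sqrt{1-g^2/4}$, $G=g/h$, and let $$K=\sqrt{b^2+gqb+q^2}\;e^{\frac12 G\Phi},\qquad \Phi=\pm\frac{\pi}{2}+\arctan\frac G2-\arctan\frac{q+\frac g2 b}{hb}$$ (sign $+$ for $b>0$, $-$ for $b<0$, and $\Phi=\arctan\frac G2$, the common limit, for $b=0$, $q>0$) be the Finsleroid–Finsler metric function with constant charge $g$. Assume that $\nabla_jb_i=k(x)\,(a_{ij}-b_ib_j)$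 for some function $k$ on $M$. Then at every $(x,y)$ with $q>0$ (that is, $y$ not proportional to $b^i$) the function $K$ is of class $C^\infty$, its metric tensor $g_{ij}=\frac12\,\partial^2K^2/\partial y^i\partial y^j$ is invertible, and: 1. The geodesic spray coefficients $G^i=\gamma^i_{nm}y^ny^m$ of $K$ (where $\gamma^i_{nm}$ are the Christoffel symbols of $g_{ij}$ with respect to $x$) are of the Landsberg type $G^i=c\,q\,(y^i-bb^i)+a^i_{km}y^ky^m$ with $c=kg$. 2. The coefficients $G^i_{kmn}=\partial^3G^i/\partial y^k\partial y^m\partial y^n$ are $$G^i_{kmn}=\frac cq\left(\eta^i_k\eta_{mn}+\eta^i_m\eta_{kn}+\eta^i_n\eta_{km}\right),\qquad c=kg.$$ Call $K$ of Berwald type if $G^i_{kmn}=0$ at all $(x,y)$ with $q>0$. 3. If $N\ge3$, then $K$ is of Berwald type if and only if $g=0$ (the Riemannian case) or $k=0$ everywhere on $M$; thus, for $g\ne0$, the Berwald case is exactly $k\equiv0$. 4. If $N=2$, then $K$ is always of Berwald type. -/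

import Mathlib

open scoped Manifold ContDiff
open Bundle

noncomputable section

namespace Finsleroid

/-- The coordinate space `ℝ^N`. -/
abbrev Coord (N : ℕ) : Type := EuclideanSpace ℝ (Fin N)

/-! ### Local coordinate calculus on `ℝ^N` -/

/-- The `j`-th coordinate vector. -/
def basisVec {N : ℕ} (j : Fin N) : Coord N := EuclideanSpace.single j (1 : ℝ)

/-- The `j`-th partial derivative of a function of `N` real variables. -/
def pderiv {N : ℕ} (j : Fin N) (f : Coord N → ℝ) (x : Coord N) : ℝ :=
  fderiv ℝ f x (basisVec j)

/-- Christoffel symbols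
`Γ^k_{ij} = ½ h^{kn} (∂_j h_{ni} + ∂_i h_{nj} - ∂_n h_{ji})`
of a field of symmetric matrices `h` (derivatives with respect to the base coordinates). -/
def christoffel {N : ℕ} (h : Coord N → Matrix (Fin N) (Fin N) ℝ)
    (k i j : Fin N) (x : Coord N) : ℝ :=
  (1 / 2 : ℝ) * ∑ n, (h x)⁻¹ k n *
    (pderiv j (fun z => h z n i) x + pderiv i (fun z => h z n j) x
      - pderiv n (fun z => h z j i) x)

/-- Coordinate components of the covariant derivative
`∇_j β_i = ∂_j β_i - Γ^m_{ij} β_m` of a covector field `β`,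
for the Riemannian metric with components `A`. -/
def covDeriv {N : ℕ} (A : Coord N → Matrix (Fin N) (Fin N) ℝ)
    (β : Fin N → Coord N → ℝ) (j i : Fin N) (x : Coord N) : ℝ :=
  pderiv j (β i) x - ∑ m, christoffel A m i j x * β m x

/-- The Finslerian metric tensor `g_{ij} = ½ ∂²F²/∂y^i∂y^j`. -/
def fundTensor {N : ℕ} (F : Coord N → Coord N → ℝ) (x y : Coord N) :
    Matrix (Fin N) (Fin N) ℝ :=
  Matrix.of fun i j =>
    (1 / 2 : ℝ) * pderiv j (fun w => pderiv i (fun u => F x u ^ 2) w) y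

/-- The geodesic spray coefficients `G^i = γ^i_{nm} y^n y^m`, with `γ` the Finslerian
Christoffel symbols (those of `g_{ij}(x, y)`, differentiated in `x` at fixed `y`). -/
def spray {N : ℕ} (F : Coord N → Coord N → ℝ) (i : Fin N) (x y : Coord N) : ℝ :=
  ∑ n, ∑ m, christoffel (fun z => fundTensor F z y) i n m x * y n * y m

/-- `G^i_{kmn} = ∂³G^i/∂y^k∂y^m∂y^n`. -/
def spray3 {N : ℕ} (F : Coord N → Coord N → ℝ) (i k m n : Fin N) (x y : Coord N) : ℝ :=
  pderiv n (pderiv m (pderiv k (fun w => spray F i x w))) y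

/-! ### Algebra attached to the components of a Riemannian metric `A` and a 1-form `β`
at one point -/

section Algebra

variable {N : ℕ} (A : Matrix (Fin N) (Fin N) ℝ) (β : Fin N → ℝ)

/-- `b^i = a^{ij} b_j`. -/
def bUp (i : Fin N) : ℝ := ∑ j, A⁻¹ i j * β j

/-- `b = b_i y^i`. -/
def bVal (y : Coord N) : ℝ := ∑ i, β i * y i

/-- `r_{ij} = a_{ij} - b_i b_j`. -/
def rLow (i j : Fin N) : ℝ := A i j - β i * β j

/-- `r^i_j = a^{im} r_{mj}`. -/
def rMix (i j : Fin N) : ℝ := ∑ m, A⁻¹ i m * rLow A β m j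

/-- `q = √(r_{ij} y^i y^j)`. -/
def qVal (y : Coord N) : ℝ := Real.sqrt (∑ i, ∑ j, rLow A β i j * y i * y j)

/-- `v^i = y^i - b b^i`. -/
def vUp (y : Coord N) (i : Fin N) : ℝ := y i - bVal β y * bUp A β i

/-- `v_i = a_{ij} y^j - b b_i`. -/
def vLow (y : Coord N) (i : Fin N) : ℝ := (∑ j, A i j * y j) - bVal β y * β i

/-- `η^i_j = r^i_j - v^i v_j / q²`. -/
def etaMix (y : Coord N) (i j : Fin N) : ℝ :=
  rMix A β i j - vUp A β y i * vLow A β y j / qVal A β y ^ 2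

/-- `η_{ij} = r_{ij} - v_i v_j / q²`. -/
def etaLow (y : Coord N) (i j : Fin N) : ℝ :=
  rLow A β i j - vLow A β y i * vLow A β y j / qVal A β y ^ 2

end Algebra

/-- The Landsberg-type spray coefficients with scalar `c`:
`G^i = c q (y^i - b b^i) + a^i_{km} y^k y^m`, where `a^i_{km}` are the Christoffel symbols
of the Riemannian metric. -/
def landsbergSpray {N : ℕ} (A : Coord N → Matrix (Fin N) (Fin N) ℝ)
    (β : Fin N → Coord N → ℝ) (c : ℝ) (i : Fin N) (x y : Coord N) : ℝ :=
  c * qVal (A x) (fun j => β j x) y * vUp (A x) (fun j => β j x) y i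
    + ∑ k, ∑ m, christoffel A i k m x * y k * y m

/-! ### The Finsleroid metric function -/

/-- The function `Φ`, in terms of the values of `b` and `q`. For `b = 0` (and `q > 0`) the
quotient `L / (h b)` is infinite, and `Φ` takes the common one-sided limit `arctan (G / 2)`. -/
def finsleroidPhi (g b q : ℝ) : ℝ :=
  let h := Real.sqrt (1 - g ^ 2 / 4)
  let G := g / h
  let L := q + g / 2 * b
  if 0 < b then Real.pi / 2 + Real.arctan (G / 2) - Real.arctan (L / (h * b))
  else if b < 0 then -(Real.pi / 2) + Real.arctan (G / 2) - Real.arctan (L / (h * b))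
  else Real.arctan (G / 2)

/-- `K = √B · exp (½ G Φ)`, with `B = b² + g q b + q²`, in terms of the values of `b`, `q`. -/
def finsleroidFun (g b q : ℝ) : ℝ :=
  Real.sqrt (b ^ 2 + g * q * b + q ^ 2) *
    Real.exp (g / Real.sqrt (1 - g ^ 2 / 4) / 2 * finsleroidPhi g b q)

/-! ### Objects on a manifold and their components in charts -/

section Manifold

variable {N : ℕ} {M : Type*} [TopologicalSpace M] [ChartedSpace (Coord N) M]

/-- The charts of the smooth structure. -/
def charts (N : ℕ) (M : Type*) [TopologicalSpace M] [ChartedSpace (Coord N) M] :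
    Set (OpenPartialHomeomorph M (Coord N)) :=
  IsManifold.maximalAtlas (𝓡 N) ∞ M

/-- The tangent vector `y^i ∂/∂x^i` at the point of `M` with coordinates `x` in the chart `e`. -/
def tangentOf (e : OpenPartialHomeomorph M (Coord N)) (x y : Coord N) :
    TangentSpace (𝓡 N) (e.symm x) :=
  letI : ChartedSpace (Coord N) (Coord N) := chartedSpaceSelf (Coord N)
  mfderiv (𝓡 N) (𝓡 N) e.symm x y

/-- A function on the tangent bundle in the local coordinates `(x, y)` given by a chart. -/
def localFun (F : ∀ p : M, TangentSpace (𝓡 N) p → ℝ)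
    (e : OpenPartialHomeomorph M (Coord N)) (x y : Coord N) : ℝ :=
  F (e.symm x) (tangentOf e x y)

variable [IsManifold (𝓡 N) ∞ M]

/-- A smooth Riemannian metric on `M`. -/
abbrev Metric (N : ℕ) (M : Type*) [TopologicalSpace M] [ChartedSpace (Coord N) M]
    [IsManifold (𝓡 N) ∞ M] :=
  ContMDiffRiemannianMetric (𝓡 N) ∞ (Coord N) (fun p : M => TangentSpace (𝓡 N) p)

/-- The components `a_{ij}` of a Riemannian metric in a chart. -/
def metricComp (a : Metric N M) (e : OpenPartialHomeomorph M (Coord N)) (x : Coord N) :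
    Matrix (Fin N) (Fin N) ℝ :=
  Matrix.of fun i j =>
    a.inner (e.symm x) (tangentOf e x (basisVec i)) (tangentOf e x (basisVec j))

/-- A 1-form on `M`, not yet assumed to be smooth. -/
abbrev OneForm (N : ℕ) (M : Type*) [TopologicalSpace M] [ChartedSpace (Coord N) M] :=
  ∀ p : M, TangentSpace (𝓡 N) p →L[ℝ] ℝ

/-- Smoothness of a 1-form, as a section of the cotangent bundle. -/
def SmoothOneForm (b : OneForm N M) : Prop :=
  ContMDiff (𝓡 N) ((𝓡 N).prod 𝓘(ℝ, Coord N →L[ℝ] ℝ)) ∞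
    (fun p : M => TotalSpace.mk' (Coord N →L[ℝ] ℝ)
      (E := fun p : M => TangentSpace (𝓡 N) p →L[ℝ] Trivial M ℝ p) p (b p))

/-- The components `b_i` of a 1-form in a chart. -/
def formComp (b : OneForm N M) (e : OpenPartialHomeomorph M (Coord N)) (i : Fin N)
    (x : Coord N) : ℝ :=
  b (e.symm x) (tangentOf e x (basisVec i))

/-- `‖b‖ = 1`, i.e. `a^{ij} b_i b_j = 1` in every chart. -/
def HasUnitLength (a : Metric N M) (b : OneForm N M) : Prop :=
  ∀ e ∈ charts N M, ∀ x ∈ e.target,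
    ∑ i, ∑ j, (metricComp a e x)⁻¹ i j * formComp b e i x * formComp b e j x = 1

/-- The condition `∇_j b_i = k (a_{ij} - b_i b_j)`, in every chart. -/
def NablaCondition (a : Metric N M) (b : OneForm N M) (k : M → ℝ) : Prop :=
  ∀ e ∈ charts N M, ∀ x ∈ e.target, ∀ j i : Fin N,
    covDeriv (metricComp a e) (formComp b e) j i x =
      k (e.symm x) * (metricComp a e x i j - formComp b e i x * formComp b e j x)

/-- The scalar `q = √(S² - b²)` on the tangent bundle. -/
def qScalar (a : Metric N M) (b : OneForm N M) (p : M) (v : TangentSpace (𝓡 N) p) : ℝ :=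
  Real.sqrt (a.inner p v v - b p v ^ 2)

/-- The Finsleroid–Finsler metric function `K` on the tangent bundle, with constant charge `g`. -/
def finsleroidK (a : Metric N M) (b : OneForm N M) (g : ℝ) (p : M)
    (v : TangentSpace (𝓡 N) p) : ℝ :=
  finsleroidFun g (b p v) (qScalar a b p v)

/-- The tangent vectors with `q > 0`, that is, those not proportional to the unit vector `b^i`:
the region where the Finsleroid–Finsler metric function is of class `C^∞`. -/
def regularDomain (a : Metric N M) (b : OneForm N M) (p : M) : Set (TangentSpace (𝓡 N) p) :=
  {v | 0 < qScalar a b p v}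

/-- `F` is of Berwald type on the domain `D` of tangent vectors: the coefficients `G^i_{kmn}` of
its geodesic spray vanish identically on `D`, in every chart. -/
def IsBerwaldOn (F : ∀ p : M, TangentSpace (𝓡 N) p → ℝ)
    (D : ∀ p : M, Set (TangentSpace (𝓡 N) p)) : Prop :=
  ∀ e ∈ charts N M, ∀ x ∈ e.target, ∀ y : Coord N, tangentOf e x y ∈ D (e.symm x) →
    ∀ i k m n : Fin N, spray3 (localFun F e) i k m n x y = 0

end Manifold

end Finsleroid

end

namespace Finsleroid

/-! ### The two-variable function behind the Finsleroid metric -/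

section TwoVariable

variable {g : ℝ}

/-! The delicate ingredient of K is Φ. Up to the constant arctan (G/2) it is the argument of the
complex number (q + g b/2) + i h b, whose squared modulus is B = b² + g q b + q² and which stays off
the branch cut when q > 0 (`phaseVec_mem_slitPlane`, `finsleroidPhi_eq`). Hence K is smooth across b
= 0, and d e^{GΦ} = e^{GΦ} (g/B) (q db − b dq). In dK² the denominators cancel: dK² = 2 e^{GΦ} (g q
db + ½ dS²) with S² = a_ij y^i y^j (`HasFDerivAt.finsleroidFun_sq`). This serves for differentiation
both in y and in x.

In y it yields the covector p_i = e^{GΦ} (g q b_i + a_ij y^j) and g_ij = ∂p_i/∂y^j, which is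
invertible (`det_metricTensor_ne_zero`). Since g_ij y^j = p_i and g_ij y^i y^j = K², the lowered
spray is y^m ∂_m p_l − ½ ∂_l K², so the x-derivatives of g_ij never have to be computed. The
hypothesis on ∇b makes b_i closed and evaluates y^m ∂_m b; with this, g_ij applied to the Landsberg
candidate is checked to give the same covector (`spray_eq_landsbergSpray`).

Three y-derivatives kill the quadratic Riemannian part and leave those of c q v^i, the symmetrised
product of η's times c/q (`pderiv₃_radial_spray`). The tensor η_ij annihilates b^i and v^i. For N =
2 these span, so η_ij = 0 (`etaLow_eq_zero`). For N ≥ 3 a vector u orthogonal to both contracts the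
product to 3 u^i a(u,u) ≠ 0, so the Berwald property forces g k = 0 at every point
(`exists_etaSymm_ne_zero`). -/

lemma discr_pos (hg : -2 < g) (hg' : g < 2) : 0 < 1 - g ^ 2 / 4 := by nlinarith

lemma hVal_pos (hg : -2 < g) (hg' : g < 2) : 0 < √(1 - g ^ 2 / 4) :=
  Real.sqrt_pos.2 (discr_pos hg hg')

/-- Completing the square exhibits B as the squared modulus of `phaseVec`; this is why B is the
denominator in the derivative of Φ. -/
lemma quadForm_eq (hg : -2 < g) (hg' : g < 2) (b q : ℝ) :
    b ^ 2 + g * q * b + q ^ 2 = (q + g / 2 * b) ^ 2 + (√(1 - g ^ 2 / 4) * b) ^ 2 := by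
  rw [mul_pow, Real.sq_sqrt (discr_pos hg hg').le]; ring

lemma quadForm_pos (hg : -2 < g) (hg' : g < 2) (b : ℝ) {q : ℝ} (hq : 0 < q) :
    0 < b ^ 2 + g * q * b + q ^ 2 := by
  nlinarith [sq_nonneg (b + g * q / 2), mul_pos (discr_pos hg hg') (pow_pos hq 2)]

/-- The complex number whose argument is `Φ - arctan (G / 2)`. -/
noncomputable def phaseVec (g b q : ℝ) : ℂ := ⟨q + g / 2 * b, √(1 - g ^ 2 / 4) * b⟩

/-- The vector is real only for b = 0, and there it equals q > 0. -/
lemma phaseVec_mem_slitPlane (hg : -2 < g) (hg' : g < 2) (b : ℝ) {q : ℝ} (hq : 0 < q) :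
    phaseVec g b q ∈ Complex.slitPlane := by
  rw [Complex.mem_slitPlane_iff]
  by_cases hb : b = 0
  · left; simp [phaseVec, hb, hq]
  · right; exact mul_ne_zero (hVal_pos hg hg').ne' hb

/-- The angle π/2 − arctan (x/y) lies in (0, π), and together with the modulus y √(1 + (x/y)²) it is
the polar form of the number. -/
lemma arg_mk_of_im_pos (x : ℝ) {y : ℝ} (hy : 0 < y) :
    Complex.arg ⟨x, y⟩ = Real.pi / 2 - Real.arctan (x / y) := by
  have h1 := Real.neg_pi_div_two_lt_arctan (x / y)
  have h2 := Real.arctan_lt_pi_div_two (x / y)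
  have hs : 0 < √(1 + (x / y) ^ 2) := Real.sqrt_pos.2 (by positivity)
  have key := Complex.arg_mul_cos_add_sin_mul_I (r := y * √(1 + (x / y) ^ 2)) (by positivity)
    (θ := Real.pi / 2 - Real.arctan (x / y)) ⟨by linarith, by linarith⟩
  rw [← key]
  congr 1
  rw [← Complex.ofReal_cos, ← Complex.ofReal_sin, Real.cos_pi_div_two_sub,
    Real.sin_pi_div_two_sub, Real.sin_arctan, Real.cos_arctan]
  apply Complex.ext <;> simp <;> field_simp

lemma arg_mk_of_im_neg (x : ℝ) {y : ℝ} (hy : y < 0) :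
    Complex.arg ⟨x, y⟩ = -(Real.pi / 2) - Real.arctan (x / y) := by
  have h : (⟨x, y⟩ : ℂ) = (starRingEnd ℂ) ⟨x, -y⟩ := by apply Complex.ext <;> simp
  have h0 := arg_mk_of_im_pos x (neg_pos.2 hy)
  have h1 := Real.neg_pi_div_two_lt_arctan (x / -y)
  rw [h, Complex.arg_conj, if_neg, h0, div_neg, Real.arctan_neg]
  · ring
  · rw [h0]; linarith [Real.pi_pos]

/-- The three cases of the definition merge into one branch of the logarithm, so smoothness at b = 0
needs no separate argument. -/
lemma finsleroidPhi_eq (hg : -2 < g) (hg' : g < 2) (b : ℝ) {q : ℝ} (hq : 0 < q) :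
    finsleroidPhi g b q =
      Real.arctan (g / √(1 - g ^ 2 / 4) / 2) + (Complex.log (phaseVec g b q)).im := by
  have hh := hVal_pos hg hg'
  rw [Complex.log_im, phaseVec, finsleroidPhi]
  rcases lt_trichotomy b 0 with hb | hb | hb
  · rw [arg_mk_of_im_neg _ (mul_neg_of_pos_of_neg hh hb)]
    simp only [if_neg hb.not_gt, if_pos hb]; ring
  · subst hb
    have : (⟨q + g / 2 * 0, √(1 - g ^ 2 / 4) * 0⟩ : ℂ) = (q : ℂ) := by
      apply Complex.ext <;> simp
    rw [this, Complex.arg_ofReal_of_nonneg hq.le]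
    simp
  · rw [arg_mk_of_im_pos _ (mul_pos hh hb)]
    simp only [if_pos hb]; ring

/-- The factor `exp (G Φ)`. -/
noncomputable def expFactor (g b q : ℝ) : ℝ :=
  Real.exp (g / √(1 - g ^ 2 / 4) * finsleroidPhi g b q)

lemma expFactor_pos (g b q : ℝ) : 0 < expFactor g b q := Real.exp_pos _

lemma finsleroidFun_sq (hg : -2 < g) (hg' : g < 2) (b : ℝ) {q : ℝ} (hq : 0 < q) :
    finsleroidFun g b q ^ 2 = (b ^ 2 + g * q * b + q ^ 2) * expFactor g b q := by
  rw [finsleroidFun, mul_pow, Real.sq_sqrt (quadForm_pos hg hg' b hq).le, ← Real.exp_nat_mul,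
    expFactor]
  congr 2; push_cast; ring

variable {V : Type*} [NormedAddCommGroup V] [NormedSpace ℝ V] {z : V}

lemma ContDiffAt.finsleroidFun (hg : -2 < g) (hg' : g < 2) {n : WithTop ℕ∞} {b q : V → ℝ}
    (hb : ContDiffAt ℝ n b z) (hq : ContDiffAt ℝ n q z) (hpos : 0 < q z) :
    ContDiffAt ℝ n (fun w => Finsleroid.finsleroidFun g (b w) (q w)) z := by
  have hphase : ContDiffAt ℝ n (fun w => phaseVec g (b w) (q w)) z := by
    have h : ContDiffAt ℝ n (fun w => Complex.equivRealProdCLM.symm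
        (q w + g / 2 * b w, √(1 - g ^ 2 / 4) * b w)) z :=
      Complex.equivRealProdCLM.symm.contDiff.contDiffAt.comp z
        ((hq.add (contDiffAt_const.mul hb)).prodMk (contDiffAt_const.mul hb))
    refine h.congr_of_eventuallyEq (.of_forall fun w => ?_)
    apply Complex.ext <;> simp [phaseVec]
  have hlog : ContDiffAt ℝ n (fun w => (Complex.log (phaseVec g (b w) (q w))).im) z := by
    have hlog' : ContDiffAt ℝ n Complex.log (phaseVec g (b z) (q z)) :=
      (Complex.contDiffAt_log (phaseVec_mem_slitPlane hg hg' (b z) hpos)).restrict_scalars ℝ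
    exact Complex.imCLM.contDiff.contDiffAt.comp z (hlog'.comp z hphase)
  have hsqrt := (((hb.pow 2).add ((contDiffAt_const (c := g)).mul hq |>.mul hb)).add
    (hq.pow 2)).sqrt (quadForm_pos hg hg' (b z) hpos).ne'
  have hexp := ((contDiffAt_const (c := g / √(1 - g ^ 2 / 4) / 2)).mul
    ((contDiffAt_const (c := Real.arctan (g / √(1 - g ^ 2 / 4) / 2))).add hlog)).exp
  refine (hsqrt.mul hexp).congr_of_eventuallyEq ?_
  -- The logarithmic formula for Φ requires q > 0, which persists near z.
  filter_upwards [hq.continuousAt.eventually (lt_mem_nhds hpos)] with w hw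
  simp only [Finsleroid.finsleroidFun, finsleroidPhi_eq hg hg' _ hw]

/-- `d e^{GΦ} = e^{GΦ} (g / B) (q db - b dq)`. -/
lemma HasFDerivAt.expFactor (hg : -2 < g) (hg' : g < 2) {b q : V → ℝ} {b' q' : V →L[ℝ] ℝ}
    (hb : HasFDerivAt b b' z) (hq : HasFDerivAt q q' z) (hpos : 0 < q z) :
    HasFDerivAt (fun w => Finsleroid.expFactor g (b w) (q w))
      ((Finsleroid.expFactor g (b z) (q z) * (g / (b z ^ 2 + g * q z * b z + q z ^ 2))) •
        (q z • b' - b z • q')) z := by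
  have hh := hVal_pos hg hg'
  have hB := quadForm_pos hg hg' (b z) hpos
  have hphase : HasFDerivAt (fun w => phaseVec g (b w) (q w))
      (((Complex.equivRealProdCLM.symm : ℝ × ℝ →L[ℝ] ℂ)).comp
        ((q' + (g / 2) • b').prod (√(1 - g ^ 2 / 4) • b'))) z := by
    have h := (Complex.equivRealProdCLM.symm : ℝ × ℝ →L[ℝ] ℂ).hasFDerivAt.comp z
      ((hq.fun_add (hb.const_mul (g / 2))).prodMk (hb.const_mul (√(1 - g ^ 2 / 4))))
    refine h.congr_of_eventuallyEq (.of_forall fun w => ?_)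
    apply Complex.ext <;> simp [phaseVec]
  have hlog := (Complex.imCLM.hasFDerivAt.comp z
    ((Complex.hasStrictDerivAt_log (phaseVec_mem_slitPlane hg hg' (b z)
      hpos)).hasDerivAt.complexToReal_fderiv.comp z hphase))
  have hexp := ((hlog.const_add (Real.arctan (g / √(1 - g ^ 2 / 4) / 2))).const_mul
    (g / √(1 - g ^ 2 / 4))).exp
  have hE : ∀ᶠ w in nhds z, Finsleroid.expFactor g (b w) (q w) =
      Real.exp (g / √(1 - g ^ 2 / 4) * (Real.arctan (g / √(1 - g ^ 2 / 4) / 2) +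
        (Complex.log (phaseVec g (b w) (q w))).im)) := by
    filter_upwards [hq.continuousAt.eventually (lt_mem_nhds hpos)] with w hw
    rw [Finsleroid.expFactor, finsleroidPhi_eq hg hg' _ hw]
  refine (hexp.congr_of_eventuallyEq hE).congr_fderiv ?_
  have hn : Complex.normSq (phaseVec g (b z) (q z)) =
      b z ^ 2 + g * q z * b z + q z ^ 2 := by
    rw [quadForm_eq hg hg', Complex.normSq_apply, phaseVec]; ring
  ext w
  simp only [Function.comp_apply, Complex.imCLM_apply, hE.self_of_nhds, ← smul_smul]
  simp [Complex.inv_re, Complex.inv_im, hn]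
  simp only [phaseVec]
  generalize b z ^ 2 + g * q z * b z + q z ^ 2 = B at hB
  generalize √(1 - g ^ 2 / 4) = h at hh
  field_simp
  ring

/-- The norm of the component orthogonal to the 1-form, as a function of `b` and `S²`. -/
lemma HasFDerivAt.orthNorm {b S : V → ℝ} {b' S' : V →L[ℝ] ℝ}
    (hb : HasFDerivAt b b' z) (hS : HasFDerivAt S S' z) (hpos : 0 < √(S z - b z ^ 2)) :
    HasFDerivAt (fun w => √(S w - b w ^ 2))
      ((√(S z - b z ^ 2))⁻¹ • ((1 / 2 : ℝ) • S' - b z • b')) z := by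
  have h := (hS.fun_sub (hb.pow 2)).sqrt (Real.sqrt_pos.1 hpos).ne'
  refine h.congr_fderiv ?_
  ext w
  simp
  field_simp

/-- `d K² = 2 e^{GΦ} (g q db + ½ dS²)`. -/
lemma HasFDerivAt.finsleroidFun_sq (hg : -2 < g) (hg' : g < 2) {b S : V → ℝ}
    {b' S' : V →L[ℝ] ℝ} (hb : HasFDerivAt b b' z) (hS : HasFDerivAt S S' z)
    (hpos : 0 < √(S z - b z ^ 2)) :
    HasFDerivAt (fun w => finsleroidFun g (b w) (√(S w - b w ^ 2)) ^ 2)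
      ((2 * Finsleroid.expFactor g (b z) (√(S z - b z ^ 2))) •
        ((g * √(S z - b z ^ 2)) • b' + (1 / 2 : ℝ) • S')) z := by
  have hq := HasFDerivAt.orthNorm hb hS hpos
  have hE := HasFDerivAt.expFactor hg hg' hb hq hpos
  have hB := quadForm_pos hg hg' (b z) hpos
  have h := (((hb.pow 2).fun_add ((hq.const_mul g).fun_mul hb)).fun_add
    (hq.pow 2)).fun_mul hE
  refine (h.congr_of_eventuallyEq ?_).congr_fderiv ?_
  · filter_upwards [hq.continuousAt.eventually (lt_mem_nhds hpos)] with w hw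
    exact Finsleroid.finsleroidFun_sq hg hg' _ hw
  · ext w
    set q := √(S z - b z ^ 2)
    set E := Finsleroid.expFactor g (b z) q
    simp only [add_apply, smul_apply, smul_eq_mul, sub_apply, nsmul_eq_mul,
      Nat.cast_ofNat, Nat.add_one_sub_one, pow_one]
    -- The B in dB + (B g/B)(q db − b dq) cancels, as do the terms g b dq, leaving 2 (g q db + b db
    -- + q dq), and b db + q dq = ½ dS². Naming B keeps it atomic for `field_simp`.
    obtain ⟨B, hBdef⟩ : ∃ B, B = b z ^ 2 + g * q * b z + q ^ 2 := ⟨_, rfl⟩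
    rw [← hBdef] at hB ⊢
    field_simp
    ring

/-- The derivative of `e^{GΦ} (g q β + α)`. -/
lemma HasFDerivAt.expFactor_mul (hg : -2 < g) (hg' : g < 2) {b S β α : V → ℝ}
    {b' S' β' α' : V →L[ℝ] ℝ} (hb : HasFDerivAt b b' z) (hS : HasFDerivAt S S' z)
    (hβ : HasFDerivAt β β' z) (hα : HasFDerivAt α α' z)
    (hpos : 0 < √(S z - b z ^ 2)) {B q E : ℝ} {q' : V →L[ℝ] ℝ}
    (hq : q = √(S z - b z ^ 2)) (hE : E = Finsleroid.expFactor g (b z) q)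
    (hB : B = b z ^ 2 + g * q * b z + q ^ 2) (hq' : q' = q⁻¹ • ((1 / 2 : ℝ) • S' - b z • b')) :
    HasFDerivAt (fun w => Finsleroid.expFactor g (b w) (√(S w - b w ^ 2)) *
        (g * √(S w - b w ^ 2) * β w + α w))
      (E • ((g / B * (g * q * β z + α z)) • (q • b' - b z • q') +
        (g * β z) • q' + (g * q) • β' + α')) z := by
  subst hB hq' hE hq
  have hq := HasFDerivAt.orthNorm hb hS hpos
  have hE := HasFDerivAt.expFactor hg hg' hb hq hpos
  refine (hE.fun_mul (((hq.const_mul g).fun_mul hβ).fun_add hα)).congr_fderiv ?_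
  ext w
  set q := √(S z - b z ^ 2)
  simp
  ring

end TwoVariable

open Matrix

variable {N : ℕ}

/-! ### Coordinate calculus -/

lemma basisVec_apply (i j : Fin N) : basisVec j i = if i = j then (1 : ℝ) else 0 := by
  simp [basisVec]

/-- The linear functional with coefficients `c`. -/
noncomputable def coordCLM (c : Fin N → ℝ) : Coord N →L[ℝ] ℝ := ∑ i, c i • EuclideanSpace.proj i

lemma coordCLM_apply (c : Fin N → ℝ) (w : Coord N) : coordCLM c w = c ⬝ᵥ w.ofLp := by
  simp [coordCLM, dotProduct]

@[simp] lemma coordCLM_basisVec (c : Fin N → ℝ) (j : Fin N) : coordCLM c (basisVec j) = c j := by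
  simp [coordCLM, basisVec]

lemma HasFDerivAt.pderiv_eq {f : Coord N → ℝ} {f' : Coord N →L[ℝ] ℝ} {x : Coord N}
    (h : HasFDerivAt f f' x) (j : Fin N) : pderiv j f x = f' (basisVec j) := by
  rw [pderiv, h.fderiv]

lemma pderiv_congr {f f₁ : Coord N → ℝ} {x : Coord N} (h : f =ᶠ[nhds x] f₁) (j : Fin N) :
    pderiv j f x = pderiv j f₁ x := by
  rw [pderiv, h.fderiv_eq, pderiv]

lemma pderiv_sum {ι : Type*} {s : Finset ι} {f : ι → Coord N → ℝ} {x : Coord N}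
    (h : ∀ i ∈ s, DifferentiableAt ℝ (f i) x) (j : Fin N) :
    pderiv j (fun z => ∑ i ∈ s, f i z) x = ∑ i ∈ s, pderiv j (f i) x := by
  simp [pderiv, fderiv_fun_sum h]

lemma pderiv_mul_const {f : Coord N → ℝ} {x : Coord N} (h : DifferentiableAt ℝ f x) (c : ℝ)
    (j : Fin N) : pderiv j (fun z => f z * c) x = pderiv j f x * c := by
  rw [pderiv, fderiv_mul_const h, _root_.smul_apply, smul_eq_mul, mul_comm, pderiv]

/-- The lowered Christoffel symbols contracted twice with `y`. -/
lemma sum_christoffel {h : Coord N → Matrix (Fin N) (Fin N) ℝ} {x : Coord N}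
    (hd : ∀ i j, DifferentiableAt ℝ (fun z => h z i j) x) (i : Fin N) (y : Fin N → ℝ) :
    ∑ n, ∑ m, christoffel h i n m x * y n * y m =
      ((h x)⁻¹ *ᵥ fun l => ∑ m, y m * pderiv m (fun z => (h z *ᵥ y) l) x -
        1 / 2 * pderiv l (fun z => y ⬝ᵥ h z *ᵥ y) x) i := by
  have h1 : ∀ l m, pderiv m (fun z => (h z *ᵥ y) l) x =
      ∑ n, pderiv m (fun z => h z l n) x * y n := by
    intro l m
    simp only [mulVec, dotProduct]
    rw [pderiv_sum fun n _ => (hd l n).mul_const _]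
    exact Finset.sum_congr rfl fun n _ => pderiv_mul_const (hd l n) _ _
  have h2 : ∀ l, pderiv l (fun z => y ⬝ᵥ h z *ᵥ y) x =
      ∑ m, ∑ n, pderiv l (fun z => h z m n) x * y n * y m := by
    intro l
    have : (fun z => y ⬝ᵥ h z *ᵥ y) = fun z => ∑ m, (∑ n, h z m n * y n) * y m := by
      ext z; simp only [mulVec, dotProduct, mul_comm (y _)]
    have hs : ∀ m, DifferentiableAt ℝ (fun z => ∑ n, h z m n * y n) x := fun m =>
      DifferentiableAt.fun_sum fun n _ => (hd m n).mul_const _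
    rw [this, pderiv_sum fun m _ => (hs m).mul_const _]
    refine Finset.sum_congr rfl fun m _ => ?_
    rw [pderiv_mul_const (hs m), pderiv_sum fun n _ => (hd m n).mul_const _, Finset.sum_mul]
    exact Finset.sum_congr rfl fun n _ => by rw [pderiv_mul_const (hd m n)]
  simp only [h1, h2, christoffel]
  set H := (h x)⁻¹
  have h3 : ∀ n m, 1 / 2 * (∑ l, H i l * (pderiv m (fun z => h z l n) x +
      pderiv n (fun z => h z l m) x - pderiv l (fun z => h z m n) x)) * y n * y m =
      ∑ l, H i l * (1 / 2 * (y m * (pderiv m (fun z => h z l n) x * y n)) +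
        1 / 2 * (y n * (pderiv n (fun z => h z l m) x * y m)) -
          1 / 2 * (pderiv l (fun z => h z m n) x * y n * y m)) := by
    intro n m
    rw [Finset.mul_sum, Finset.sum_mul, Finset.sum_mul]
    exact Finset.sum_congr rfl fun l _ => by ring
  simp only [h3]
  rw [Finset.sum_congr rfl fun n _ => Finset.sum_comm, Finset.sum_comm]
  simp only [mulVec, dotProduct]
  refine Finset.sum_congr rfl fun l _ => ?_
  simp only [← Finset.mul_sum, Finset.sum_add_distrib, Finset.sum_sub_distrib]
  congr 1
  -- Exchanging the names of n and m identifies the first two terms of the Christoffel symbol, so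
  -- symmetry of `h` plays no role.
  rw [Finset.sum_comm (f := fun n m => y m * (pderiv m (fun z => h z l n) x * y n)),
    Finset.sum_comm (f := fun n m => pderiv l (fun z => h z m n) x * y n * y m)]
  simp only [← Finset.mul_sum]
  ring

/-! ### Algebra at one point -/

section Pointwise

variable {A : Matrix (Fin N) (Fin N) ℝ} {β : Fin N → ℝ} (y : Coord N)

lemma bVal_eq : bVal β y = β ⬝ᵥ y.ofLp := rfl

lemma vUp_eq : vUp A β y = y.ofLp - bVal β y • (A⁻¹ *ᵥ β) := rfl

lemma vLow_eq : vLow A β y = A *ᵥ y.ofLp - bVal β y • β := rfl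

lemma sum_rLow : ∑ i, ∑ j, rLow A β i j * y i * y j =
    y.ofLp ⬝ᵥ A *ᵥ y.ofLp - bVal β y ^ 2 := by
  have h1 : y.ofLp ⬝ᵥ A *ᵥ y.ofLp = ∑ i, ∑ j, A i j * y i * y j := by
    simp only [dotProduct, mulVec, Finset.mul_sum]
    exact Finset.sum_congr rfl fun i _ => Finset.sum_congr rfl fun j _ => by ring
  have h2 : bVal β y ^ 2 = ∑ i, ∑ j, β i * β j * y i * y j := by
    rw [sq, bVal, Finset.sum_mul_sum]
    exact Finset.sum_congr rfl fun i _ => Finset.sum_congr rfl fun j _ => by ring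
  rw [h1, h2, ← Finset.sum_sub_distrib]
  refine Finset.sum_congr rfl fun i _ => ?_
  rw [← Finset.sum_sub_distrib]
  exact Finset.sum_congr rfl fun j _ => by rw [rLow]; ring

lemma qVal_eq : qVal A β y = √(y.ofLp ⬝ᵥ A *ᵥ y.ofLp - bVal β y ^ 2) := by
  rw [qVal, sum_rLow]

lemma qVal_sq (hq : 0 < qVal A β y) :
    qVal A β y ^ 2 = y.ofLp ⬝ᵥ A *ᵥ y.ofLp - bVal β y ^ 2 := by
  rw [qVal_eq] at hq ⊢
  exact Real.sq_sqrt (Real.sqrt_pos.1 hq).le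

lemma dotProduct_mulVec_symm (hA : A.IsSymm) (u w : Fin N → ℝ) :
    u ⬝ᵥ A *ᵥ w = (A *ᵥ u) ⬝ᵥ w := by
  rw [dotProduct_mulVec, ← mulVec_transpose, hA]

lemma dotProduct_vLow (hq : 0 < qVal A β y) : vLow A β y ⬝ᵥ y.ofLp = qVal A β y ^ 2 := by
  rw [qVal_sq y hq, vLow_eq, sub_dotProduct, smul_dotProduct, dotProduct_comm (A *ᵥ _),
    ← bVal_eq (β := β), smul_eq_mul, sq]

/-! ### Duality relations among b_i, v_i, b^i and v^i for a unit form -/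

section Unit

variable (hA : A.IsSymm) (hdet : A.det ≠ 0) (hu : ∑ i, ∑ j, A⁻¹ i j * β i * β j = 1)
include hdet

lemma mulVec_inv_mulVec (w : Fin N → ℝ) : A *ᵥ A⁻¹ *ᵥ w = w := by
  rw [mulVec_mulVec, mul_nonsing_inv _ hdet.isUnit, one_mulVec]

lemma inv_mulVec_mulVec (w : Fin N → ℝ) : A⁻¹ *ᵥ A *ᵥ w = w := by
  rw [mulVec_mulVec, nonsing_inv_mul _ hdet.isUnit, one_mulVec]

lemma mulVec_vUp : A *ᵥ vUp A β y = vLow A β y := by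
  rw [vUp_eq, vLow_eq, mulVec_sub, mulVec_smul, mulVec_inv_mulVec hdet]

lemma rMix_eq (i j : Fin N) :
    rMix A β i j = (1 : Matrix (Fin N) (Fin N) ℝ) i j - bUp A β i * β j := by
  have h : (A⁻¹ * A) i j = ∑ m, A⁻¹ i m * A m j := rfl
  rw [← nonsing_inv_mul _ hdet.isUnit, h, bUp, Finset.sum_mul, ← Finset.sum_sub_distrib, rMix]
  exact Finset.sum_congr rfl fun m _ => by rw [rLow]; ring

omit hdet
include hu

lemma dotProduct_bUp : β ⬝ᵥ A⁻¹ *ᵥ β = 1 := by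
  rw [← hu]
  simp only [dotProduct, mulVec, Finset.mul_sum]
  exact Finset.sum_congr rfl fun i _ => Finset.sum_congr rfl fun j _ => by ring

lemma dotProduct_vUp : β ⬝ᵥ vUp A β y = 0 := by
  rw [vUp_eq, dotProduct_sub, dotProduct_smul, dotProduct_bUp hu, ← bVal_eq]
  simp

include hA hdet

lemma vLow_dotProduct_bUp : vLow A β y ⬝ᵥ A⁻¹ *ᵥ β = 0 := by
  rw [vLow_eq, sub_dotProduct, smul_dotProduct, dotProduct_bUp hu, ← dotProduct_mulVec_symm hA,
    mulVec_inv_mulVec hdet, bVal_eq, dotProduct_comm]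
  simp

lemma vLow_dotProduct_vUp (hq : 0 < qVal A β y) :
    vLow A β y ⬝ᵥ vUp A β y = qVal A β y ^ 2 := by
  rw [vUp_eq, dotProduct_sub, dotProduct_smul, vLow_dotProduct_bUp y hA hdet hu,
    dotProduct_vLow y hq]
  simp

end Unit

/-! ### The Finslerian metric tensor -/

/-- The covector `½ ∂K²/∂y^i`. -/
noncomputable def momentum (g : ℝ) (A : Matrix (Fin N) (Fin N) ℝ) (β : Fin N → ℝ)
    (y : Coord N) (i : Fin N) : ℝ :=
  expFactor g (bVal β y) (qVal A β y) * (g * qVal A β y * β i + (A *ᵥ y.ofLp) i)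

/-- The explicit form of the Finslerian metric tensor of the Finsleroid metric function. -/
noncomputable def metricTensor (g : ℝ) (A : Matrix (Fin N) (Fin N) ℝ) (β : Fin N → ℝ)
    (y : Coord N) : Matrix (Fin N) (Fin N) ℝ :=
  let b := bVal β y
  let q := qVal A β y
  Matrix.of fun i j => expFactor g b q *
    (g / (b ^ 2 + g * q * b + q ^ 2) * (g * q * β i + (A *ᵥ y.ofLp) i) *
        (q * β j - b * (q⁻¹ * vLow A β y j)) +
      g * β i * (q⁻¹ * vLow A β y j) + A i j)

lemma hasFDerivAt_bVal : HasFDerivAt (fun u => bVal β u) (coordCLM β) y :=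
  (coordCLM β).hasFDerivAt.congr_of_eventuallyEq (.of_forall fun u => (coordCLM_apply β u).symm)

lemma hasFDerivAt_mulVec (i : Fin N) :
    HasFDerivAt (fun u : Coord N => (A *ᵥ u.ofLp) i) (coordCLM (A i)) y :=
  hasFDerivAt_bVal (β := A i) y

/-- Stated without symmetry so that it also applies to the matrix of Christoffel symbols in the
spray. -/
lemma hasFDerivAt_dotProduct_mulVec_self :
    HasFDerivAt (fun u : Coord N => u.ofLp ⬝ᵥ A *ᵥ u.ofLp) (coordCLM ((A + Aᵀ) *ᵥ y.ofLp)) y := by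
  have h : HasFDerivAt (fun u : Coord N => ∑ i, u i * (A *ᵥ u.ofLp) i)
      (∑ i, (y i • coordCLM (A i) + (A *ᵥ y.ofLp) i • EuclideanSpace.proj i)) y :=
    HasFDerivAt.fun_sum fun i _ => HasFDerivAt.fun_mul
      (EuclideanSpace.proj (𝕜 := ℝ) i).hasFDerivAt (hasFDerivAt_mulVec y i)
  refine h.congr_fderiv ?_
  ext w
  have h1 : ∑ i, y i * (A *ᵥ w.ofLp) i = (Aᵀ *ᵥ y.ofLp) ⬝ᵥ w.ofLp := by
    rw [mulVec_transpose, ← dotProduct_mulVec]; rfl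
  have h2 : ∑ i, (A *ᵥ y.ofLp) i * w i = (A *ᵥ y.ofLp) ⬝ᵥ w.ofLp := rfl
  have h3 : ∀ i, coordCLM (A i) w = (A *ᵥ w.ofLp) i := fun i => coordCLM_apply _ w
  simp [Finset.sum_add_distrib, h1, h2, h3, coordCLM_apply, add_mulVec, add_comm]

lemma hasFDerivAt_quadratic (hA : A.IsSymm) :
    HasFDerivAt (fun u : Coord N => u.ofLp ⬝ᵥ A *ᵥ u.ofLp) ((2 : ℝ) • coordCLM (A *ᵥ y.ofLp)) y := by
  refine (hasFDerivAt_dotProduct_mulVec_self y).congr_fderiv ?_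
  ext w
  rw [hA.eq]
  simp [coordCLM_apply, add_mulVec, two_mul]

lemma continuous_qVal : Continuous fun u : Coord N => qVal A β u := by
  unfold qVal; fun_prop

lemma eventually_qVal_pos (hq : 0 < qVal A β y) : ∀ᶠ u in nhds y, 0 < qVal A β u :=
  continuous_qVal.continuousAt.eventually (lt_mem_nhds hq)

variable {g : ℝ}

lemma pderiv_finsleroidFun_sq (hg : -2 < g) (hg' : g < 2) (hA : A.IsSymm)
    (hq : 0 < qVal A β y) (i : Fin N) :
    pderiv i (fun u => finsleroidFun g (bVal β u) (qVal A β u) ^ 2) y =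
      2 * momentum g A β y i := by
  rw [qVal_eq] at hq
  have h := HasFDerivAt.finsleroidFun_sq hg hg' (hasFDerivAt_bVal y)
    (hasFDerivAt_quadratic y hA) hq
  simp only [momentum, qVal_eq]
  rw [HasFDerivAt.pderiv_eq h]
  simp
  ring

lemma pderiv_momentum (hg : -2 < g) (hg' : g < 2) (hA : A.IsSymm)
    (hq : 0 < qVal A β y) (i j : Fin N) :
    pderiv j (fun u => momentum g A β u i) y = metricTensor g A β y i j := by
  rw [qVal_eq] at hq
  have h := HasFDerivAt.expFactor_mul hg hg' (hasFDerivAt_bVal y)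
    (hasFDerivAt_quadratic y hA) (hasFDerivAt_const (β i) y) (hasFDerivAt_mulVec (A := A) y i) hq
    rfl rfl rfl rfl
  simp only [momentum, metricTensor, qVal_eq]
  rw [HasFDerivAt.pderiv_eq h]
  simp [vLow_eq]
  ring

lemma fundTensor_eq (hg : -2 < g) (hg' : g < 2) (hA : A.IsSymm) (hq : 0 < qVal A β y)
    {F : Coord N → Coord N → ℝ} {x : Coord N}
    (hF : F x = fun u => finsleroidFun g (bVal β u) (qVal A β u)) :
    fundTensor F x y = metricTensor g A β y := by
  ext i j
  rw [← pderiv_momentum y hg hg' hA hq, fundTensor, Matrix.of_apply, hF]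
  have h : (fun w => pderiv i (fun u => finsleroidFun g (bVal β u) (qVal A β u) ^ 2) w)
      =ᶠ[nhds y] fun w => momentum g A β w i * 2 := by
    filter_upwards [eventually_qVal_pos y hq] with w hw
    rw [pderiv_finsleroidFun_sq w hg hg' hA hw, mul_comm]
  have hd : DifferentiableAt ℝ (fun w => momentum g A β w i) y := by
    rw [qVal_eq] at hq
    have h := HasFDerivAt.expFactor_mul hg hg' (hasFDerivAt_bVal y)
      (hasFDerivAt_quadratic y hA) (hasFDerivAt_const (β i) y) (hasFDerivAt_mulVec (A := A) y i) hq
      rfl rfl rfl rfl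
    simp only [momentum, qVal_eq]
    exact h.differentiableAt
  rw [pderiv_congr h, pderiv_mul_const hd]
  ring

/-- Up to the factor e^{GΦ} the tensor is A plus terms of rank one, so its action sees `w` only
through β·w, v·w and A w. -/
lemma metricTensor_mulVec (w : Fin N → ℝ) (i : Fin N) {b q : ℝ} (hb : b = bVal β y)
    (hq : q = qVal A β y) :
    (metricTensor g A β y *ᵥ w) i = expFactor g b q *
      (g / (b ^ 2 + g * q * b + q ^ 2) * (g * q * β i + (A *ᵥ y.ofLp) i) *
          (q * (β ⬝ᵥ w) - b * (q⁻¹ * (vLow A β y ⬝ᵥ w))) +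
        g * β i * (q⁻¹ * (vLow A β y ⬝ᵥ w)) + (A *ᵥ w) i) := by
  subst hb hq
  simp only [metricTensor, mulVec, dotProduct, Matrix.of_apply, Finset.mul_sum,
    ← Finset.sum_sub_distrib, ← Finset.sum_add_distrib]
  exact Finset.sum_congr rfl fun j _ => by ring

/-- Euler's relation for K²: with w = y the bracket q b − b (q²/q) vanishes, reflecting that Φ is
homogeneous of degree zero. -/
lemma metricTensor_mulVec_self (hq : 0 < qVal A β y) :
    metricTensor g A β y *ᵥ y.ofLp = momentum g A β y := by
  ext i
  rw [metricTensor_mulVec y _ i rfl rfl, dotProduct_vLow y hq, ← bVal_eq, momentum]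
  field_simp
  ring

lemma dotProduct_metricTensor_mulVec_self (hg : -2 < g) (hg' : g < 2) (hq : 0 < qVal A β y) :
    y.ofLp ⬝ᵥ metricTensor g A β y *ᵥ y.ofLp =
      finsleroidFun g (bVal β y) (qVal A β y) ^ 2 := by
  have h : momentum g A β y = expFactor g (bVal β y) (qVal A β y) •
      ((g * qVal A β y) • β + A *ᵥ y.ofLp) := rfl
  rw [metricTensor_mulVec_self y hq, finsleroidFun_sq hg hg' _ hq, h, dotProduct_smul,
    dotProduct_add, dotProduct_smul, dotProduct_comm _ β, ← bVal_eq]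
  simp only [smul_eq_mul]
  linear_combination (-expFactor g (bVal β y) (qVal A β y)) * qVal_sq y hq

/-- Pairing the equation for a kernel vector `w` with b^i and v^i shows that its components (s, t)
are −X (b, q), whereas X is itself a multiple of q s − b t. Hence X = 0, then t = 0, and A w = 0
remains. -/
lemma det_metricTensor_ne_zero (hg : -2 < g) (hg' : g < 2) (hA : A.IsSymm) (hdet : A.det ≠ 0)
    (hu : ∑ i, ∑ j, A⁻¹ i j * β i * β j = 1) (hq : 0 < qVal A β y) :
    (metricTensor g A β y).det ≠ 0 := by
  intro h0
  obtain ⟨w, hw, hw0⟩ := Matrix.exists_mulVec_eq_zero_iff.2 h0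
  obtain ⟨b, hb⟩ : ∃ b, b = bVal β y := ⟨_, rfl⟩
  obtain ⟨q, hq'⟩ : ∃ q, q = qVal A β y := ⟨_, rfl⟩
  obtain ⟨s, hs⟩ : ∃ s, s = β ⬝ᵥ w := ⟨_, rfl⟩
  obtain ⟨t, ht⟩ : ∃ t, t = q⁻¹ * (vLow A β y ⬝ᵥ w) := ⟨_, rfl⟩
  obtain ⟨X, hX⟩ : ∃ X, X = g / (b ^ 2 + g * q * b + q ^ 2) * (q * s - b * t) := ⟨_, rfl⟩
  have hqpos : 0 < q := hq'.symm ▸ hq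
  have hB := quadForm_pos hg hg' b hqpos
  have hrow : X • ((g * q) • β + A *ᵥ y.ofLp) + (g * t) • β + A *ᵥ w = 0 := by
    ext i
    have h := congrFun hw0 i
    rw [metricTensor_mulVec y w i hb hq', ← hs, ← ht] at h
    have h' := (mul_eq_zero.1 h).resolve_left (expFactor_pos g b q).ne'
    simp only [Pi.add_apply, Pi.smul_apply, smul_eq_mul, Pi.zero_apply]
    rw [← h', hX]; ring
  have hyb : (A *ᵥ y.ofLp) ⬝ᵥ A⁻¹ *ᵥ β = b := by
    rw [← dotProduct_mulVec_symm hA, mulVec_inv_mulVec hdet, dotProduct_comm, ← bVal_eq, hb]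
  have hwb : (A *ᵥ w) ⬝ᵥ A⁻¹ *ᵥ β = s := by
    rw [← dotProduct_mulVec_symm hA, mulVec_inv_mulVec hdet, dotProduct_comm, hs]
  have hyv : (A *ᵥ y.ofLp) ⬝ᵥ vUp A β y = q ^ 2 := by
    rw [← dotProduct_mulVec_symm hA, mulVec_vUp y hdet, dotProduct_comm, dotProduct_vLow y hq, hq']
  have hwv : (A *ᵥ w) ⬝ᵥ vUp A β y = q * t := by
    rw [← dotProduct_mulVec_symm hA, mulVec_vUp y hdet, dotProduct_comm, ht]
    field_simp
  have e1 : X * (g * q + b) + g * t + s = 0 := by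
    have h := congrArg (· ⬝ᵥ A⁻¹ *ᵥ β) hrow
    simpa [add_dotProduct, dotProduct_bUp hu, hyb, hwb, mul_add] using h
  have e2 : X * q ^ 2 + q * t = 0 := by
    have h := congrArg (· ⬝ᵥ vUp A β y) hrow
    simpa [add_dotProduct, dotProduct_vUp y hu, hyv, hwv] using h
  have ht' : t = -(q * X) := by
    have : q * (X * q + t) = 0 := by linear_combination e2
    linarith [(mul_eq_zero.1 this).resolve_left hqpos.ne']
  have hs' : s = -(b * X) := by rw [ht'] at e1; linear_combination e1
  -- The determinant q s − b t vanishes because (s, t) is parallel to (b, q).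
  have hX0 : X = 0 := by rw [hX, ht', hs']; ring
  have ht0 : t = 0 := by rw [ht', hX0]; simp
  rw [hX0, ht0] at hrow
  simp only [zero_smul, mul_zero, zero_add] at hrow
  apply hw
  rw [← inv_mulVec_mulVec hdet w, hrow, mulVec_zero]

end Pointwise

/-! ### The geodesic spray -/

lemma fderiv_apply_eq_sum (f : Coord N → ℝ) (x y : Coord N) :
    fderiv ℝ f x y = ∑ m, y m * pderiv m f x := by
  have hy : y = ∑ m, y m • basisVec m := by
    ext i
    simp [basisVec_apply]
  conv_lhs => rw [hy, map_sum]
  simp [pderiv]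

/-- Contraction of the Christoffel symbols of a metric depending on parameters. -/
noncomputable def contractedChristoffel (h : Coord N → Matrix (Fin N) (Fin N) ℝ) (x y : Coord N) (i : Fin N) :
    ℝ :=
  ∑ n, ∑ m, christoffel h i n m x * y n * y m

/-- Both the Finslerian and the Riemannian spray are read off from this form: only the lowered
vector h y and the quadratic form in y are differentiated. -/
lemma contractedChristoffel_eq {h : Coord N → Matrix (Fin N) (Fin N) ℝ} {x : Coord N}
    (hd : ∀ i j, DifferentiableAt ℝ (fun z => h z i j) x) (y : Coord N) :
    contractedChristoffel h x y =
      (h x)⁻¹ *ᵥ fun l => fderiv ℝ (fun z => (h z *ᵥ y.ofLp) l) x y -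
        1 / 2 * pderiv l (fun z => y.ofLp ⬝ᵥ h z *ᵥ y.ofLp) x := by
  ext i
  simp only [fderiv_apply_eq_sum]
  exact sum_christoffel hd i y.ofLp

/-! ### Differentiation in the base point and the spray equation -/

section Local

variable {A : Coord N → Matrix (Fin N) (Fin N) ℝ} {β : Fin N → Coord N → ℝ} {x : Coord N}
  (y : Coord N) {k g : ℝ}

lemma christoffel_symm (hs : ∀ᶠ z in nhds x, (A z).IsSymm) (s i j : Fin N) :
    christoffel A s i j x = christoffel A s j i x := by
  have h : ∀ n, pderiv n (fun z => A z j i) x = pderiv n (fun z => A z i j) x := fun n =>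
    pderiv_congr (hs.mono fun z hz => hz.apply i j) n
  simp only [christoffel, h]
  congr 1
  exact Finset.sum_congr rfl fun n _ => by ring

lemma differentiableAt_bVal (hβ : ∀ i, DifferentiableAt ℝ (β i) x) :
    DifferentiableAt ℝ (fun z => bVal (fun j => β j z) y) x :=
  DifferentiableAt.fun_sum fun i _ => (hβ i).mul_const _

lemma differentiableAt_mulVec (hA : ∀ i j, DifferentiableAt ℝ (fun z => A z i j) x) (i : Fin N) :
    DifferentiableAt ℝ (fun z => (A z *ᵥ y.ofLp) i) x := by
  simp only [mulVec, dotProduct]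
  exact DifferentiableAt.fun_sum fun j _ => (hA i j).mul_const _

lemma differentiableAt_quadratic (hA : ∀ i j, DifferentiableAt ℝ (fun z => A z i j) x) :
    DifferentiableAt ℝ (fun z => y.ofLp ⬝ᵥ A z *ᵥ y.ofLp) x :=
  DifferentiableAt.fun_sum fun i _ => (differentiableAt_mulVec y hA i).const_mul _

lemma pderiv_bVal (hβ : ∀ i, DifferentiableAt ℝ (β i) x) (n : Fin N) :
    pderiv n (fun z => bVal (fun j => β j z) y) x = ∑ i, y i * pderiv n (β i) x := by
  simp only [bVal]
  rw [pderiv_sum fun i _ => (hβ i).mul_const _]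
  exact Finset.sum_congr rfl fun i _ => by rw [pderiv_mul_const (hβ i), mul_comm]

lemma sum_fderiv_mulVec (hA : ∀ i j, DifferentiableAt ℝ (fun z => A z i j) x) (w : Coord N) :
    ∑ i, y i * fderiv ℝ (fun z => (A z *ᵥ y.ofLp) i) x w =
      fderiv ℝ (fun z => y.ofLp ⬝ᵥ A z *ᵥ y.ofLp) x w := by
  have h : (fun z => y.ofLp ⬝ᵥ A z *ᵥ y.ofLp) = fun z => ∑ i, y i * (A z *ᵥ y.ofLp) i := rfl
  rw [h, fderiv_fun_sum fun i _ => (differentiableAt_mulVec y hA i).const_mul _]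
  simp only [FunLike.coe_sum, Finset.sum_apply]
  refine Finset.sum_congr rfl fun i _ => ?_
  rw [fderiv_const_mul (differentiableAt_mulVec y hA i)]
  rfl

lemma hasFDerivAt_momentum_base (hg : -2 < g) (hg' : g < 2)
    (hA : ∀ i j, DifferentiableAt ℝ (fun z => A z i j) x)
    (hβ : ∀ i, DifferentiableAt ℝ (β i) x) (n : Fin N)
    {b q B E : ℝ} (hb : b = bVal (fun j => β j x) y) (hq : q = qVal (A x) (fun j => β j x) y)
    (hB : B = b ^ 2 + g * q * b + q ^ 2) (hE : E = expFactor g b q) (hpos : 0 < q)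
    {b' q' S' : Coord N →L[ℝ] ℝ} (hb' : b' = fderiv ℝ (fun z => bVal (fun j => β j z) y) x)
    (hS' : S' = fderiv ℝ (fun z => y.ofLp ⬝ᵥ A z *ᵥ y.ofLp) x)
    (hq' : q' = q⁻¹ • ((1 / 2 : ℝ) • S' - b • b')) :
    HasFDerivAt (fun z => momentum g (A z) (fun j => β j z) y n)
      (E • ((g / B * (g * q * β n x + (A x *ᵥ y.ofLp) n)) • (q • b' - b • q') +
        (g * β n x) • q' + (g * q) • fderiv ℝ (β n) x +
          fderiv ℝ (fun z => (A z *ᵥ y.ofLp) n) x)) x := by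
  subst hb hb' hS'
  rw [qVal_eq] at hq
  rw [hq] at hpos
  simp only [momentum, qVal_eq]
  exact HasFDerivAt.expFactor_mul hg hg' (differentiableAt_bVal y hβ).hasFDerivAt
    (differentiableAt_quadratic y hA).hasFDerivAt (hβ n).hasFDerivAt
    (differentiableAt_mulVec y hA n).hasFDerivAt hpos hq hE hB hq'

lemma continuousAt_qVal_base (hA : ∀ i j, DifferentiableAt ℝ (fun z => A z i j) x)
    (hβ : ∀ i, DifferentiableAt ℝ (β i) x) :
    ContinuousAt (fun z => qVal (A z) (fun j => β j z) y) x := by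
  simp only [qVal_eq]
  exact ((differentiableAt_quadratic y hA).continuousAt.sub
    ((differentiableAt_bVal y hβ).continuousAt.pow 2)).sqrt

lemma differentiableAt_metricTensor (hg : -2 < g) (hg' : g < 2)
    (hA : ∀ i j, DifferentiableAt ℝ (fun z => A z i j) x)
    (hβ : ∀ i, DifferentiableAt ℝ (β i) x) (hpos : 0 < qVal (A x) (fun j => β j x) y)
    (i j : Fin N) :
    DifferentiableAt ℝ (fun z => metricTensor g (A z) (fun j => β j z) y i j) x := by
  have hb := differentiableAt_bVal y hβ
  have hmul := differentiableAt_mulVec y hA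
  have hq : DifferentiableAt ℝ (fun z => qVal (A z) (fun j => β j z) y) x := by
    rw [qVal_eq] at hpos
    simp only [qVal_eq]
    exact (HasFDerivAt.orthNorm hb.hasFDerivAt
      (differentiableAt_quadratic y hA).hasFDerivAt hpos).differentiableAt
  have hE := (HasFDerivAt.expFactor hg hg' hb.hasFDerivAt hq.hasFDerivAt hpos).differentiableAt
  have hB := (quadForm_pos hg hg' (bVal (fun j => β j x) y) hpos).ne'
  have hv : DifferentiableAt ℝ (fun z => vLow (A z) (fun j => β j z) y j) x :=
    (hmul j).sub (hb.mul (hβ j))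
  have hq0 := hpos.ne'
  have hβi := hβ i
  have hβj := hβ j
  have hAi := hA i j
  have hmi := hmul i
  simp only [metricTensor, Matrix.of_apply]
  fun_prop (disch := assumption)

/-- Contract ∇_j b_i = k r_ij twice with y, using r_ij y^i y^j = q². -/
lemma fderiv_bVal_self (hβ : ∀ i, DifferentiableAt ℝ (β i) x)
    (hpos : 0 < qVal (A x) (fun j => β j x) y)
    (hk : ∀ j i, covDeriv A β j i x = k * (A x i j - β i x * β j x)) :
    fderiv ℝ (fun z => bVal (fun j => β j z) y) x y =
      k * qVal (A x) (fun j => β j x) y ^ 2 +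
        (fun j => β j x) ⬝ᵥ contractedChristoffel A x y := by
  have hd : ∀ j i, pderiv j (β i) x =
      k * rLow (A x) (fun j => β j x) i j + ∑ m, christoffel A m i j x * β m x := by
    intro j i
    have := hk j i
    rw [covDeriv] at this
    rw [rLow]; linarith
  rw [qVal_sq y hpos, ← sum_rLow, fderiv_apply_eq_sum]
  simp only [pderiv_bVal y hβ, hd, dotProduct, contractedChristoffel]
  simp only [mul_add, Finset.sum_add_distrib, Finset.mul_sum]
  congr 1
  · rw [Finset.sum_comm]
    exact Finset.sum_congr rfl fun i _ => Finset.sum_congr rfl fun j _ => by ring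
  · rw [Finset.sum_comm, Finset.sum_congr rfl fun i _ => Finset.sum_comm, Finset.sum_comm]
    exact Finset.sum_congr rfl fun s _ => Finset.sum_congr rfl fun i _ =>
      Finset.sum_congr rfl fun j _ => by ring

/-- As g_ij is invertible, it suffices to lower the candidate c q v^i + a^i_{km} y^k y^m with g_ij
and compare it with y^m ∂_m p_n − ½ ∂_n K². -/
lemma spray_eq_landsbergSpray (hg : -2 < g) (hg' : g < 2)
    (hs : ∀ᶠ z in nhds x, (A z).IsSymm) (hdet : (A x).det ≠ 0)
    (hu : ∑ i, ∑ j, (A x)⁻¹ i j * β i x * β j x = 1)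
    (hA : ∀ i j, DifferentiableAt ℝ (fun z => A z i j) x)
    (hβ : ∀ i, DifferentiableAt ℝ (β i) x)
    (hk : ∀ j i, covDeriv A β j i x = k * (A x i j - β i x * β j x))
    (hpos : 0 < qVal (A x) (fun j => β j x) y) {F : Coord N → Coord N → ℝ}
    (hF : ∀ z, F z = fun u =>
      finsleroidFun g (bVal (fun j => β j z) u) (qVal (A z) (fun j => β j z) u)) (i : Fin N) :
    spray F i x y = landsbergSpray A β (g * k) i x y := by
  have hsx := hs.self_of_nhds
  have hposN := (continuousAt_qVal_base y hA hβ).eventually (lt_mem_nhds hpos)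
  have hG : ∀ᶠ z in nhds x, fundTensor F z y = metricTensor g (A z) (fun j => β j z) y := by
    filter_upwards [hs, hposN] with z hz hz'
    exact fundTensor_eq y hg hg' hz hz' (hF z)
  have hGd : ∀ i j, DifferentiableAt ℝ (fun z => fundTensor F z y i j) x := fun i j =>
    (differentiableAt_metricTensor y hg hg' hA hβ hpos i j).congr_of_eventuallyEq
      (hG.mono fun z hz => by simp only [hz])
  have hp : ∀ l, (fun z => (fundTensor F z y *ᵥ y.ofLp) l) =ᶠ[nhds x]
      fun z => momentum g (A z) (fun j => β j z) y l := fun l => by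
    filter_upwards [hG, hposN] with z hz hz'
    rw [hz, metricTensor_mulVec_self y hz']
  have hQ : (fun z => y.ofLp ⬝ᵥ fundTensor F z y *ᵥ y.ofLp) =ᶠ[nhds x]
      fun z => finsleroidFun g (bVal (fun j => β j z) y) (qVal (A z) (fun j => β j z) y) ^ 2 := by
    filter_upwards [hG, hposN] with z hz hz'
    rw [hz, dotProduct_metricTensor_mulVec_self y hg hg' hz']
  have hspray : spray F i x y = contractedChristoffel (fun z => fundTensor F z y) x y i := rfl
  rw [hspray, contractedChristoffel_eq hGd, hG.self_of_nhds]
  simp only [(hp _).fderiv_eq, pderiv_congr hQ]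
  set γ := contractedChristoffel A x y with hγ
  have hland : landsbergSpray A β (g * k) i x y =
      ((g * k * qVal (A x) (fun j => β j x) y) • vUp (A x) (fun j => β j x) y + γ) i := rfl
  have hdetG := det_metricTensor_ne_zero y hg hg' hsx hdet hu hpos
  -- Writing the candidate as g⁻¹ (g · candidate) puts the inverse in front on both sides, where it
  -- can be dropped.
  rw [hland, ← inv_mulVec_mulVec hdetG
    ((g * k * qVal (A x) (fun j => β j x) y) • vUp (A x) (fun j => β j x) y + γ)]
  congr 2
  ext n
  obtain ⟨b, hb⟩ : ∃ b, b = bVal (fun j => β j x) y := ⟨_, rfl⟩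
  obtain ⟨q, hq⟩ : ∃ q, q = qVal (A x) (fun j => β j x) y := ⟨_, rfl⟩
  have hAγ : A x *ᵥ γ = fun l => fderiv ℝ (fun z => (A z *ᵥ y.ofLp) l) x y -
      1 / 2 * pderiv l (fun z => y.ofLp ⬝ᵥ A z *ᵥ y.ofLp) x := by
    rw [hγ, contractedChristoffel_eq hA, mulVec_inv_mulVec hdet]
  have hAγn := congrFun hAγ n
  -- Contracting the lowered Riemannian spray with y turns y^m ∂_m S² − ½ y^m ∂_m S² into half of
  -- the derivative of S² along y.
  have hyAγ : y.ofLp ⬝ᵥ A x *ᵥ γ =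
      1 / 2 * fderiv ℝ (fun z => y.ofLp ⬝ᵥ A z *ᵥ y.ofLp) x y := by
    rw [hAγ]
    simp only [dotProduct, mul_sub, Finset.sum_sub_distrib]
    have h1 := sum_fderiv_mulVec y hA y
    have h2 := fderiv_apply_eq_sum (fun z => y.ofLp ⬝ᵥ A z *ᵥ y.ofLp) x y
    simp only [dotProduct] at h1 h2
    rw [h1, h2, Finset.mul_sum, ← Finset.sum_sub_distrib]
    exact Finset.sum_congr rfl fun i _ => by ring
  have hbdot := fderiv_bVal_self y hβ hpos hk
  rw [← hγ, ← hq] at hbdot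
  -- The right side of the condition on ∇b is symmetric, as are the Christoffel symbols, so the
  -- 1-form is closed: y^m ∂_m b_n = ∂_n (b_m y^m).
  have hβsymm : fderiv ℝ (β n) x y = pderiv n (fun z => bVal (fun j => β j z) y) x := by
    rw [fderiv_apply_eq_sum, pderiv_bVal y hβ]
    refine Finset.sum_congr rfl fun m _ => ?_
    have h1 := hk m n
    have h2 := hk n m
    rw [covDeriv] at h1 h2
    simp only [christoffel_symm hs _ m n] at h2
    rw [hsx.apply n m] at h2
    congr 1
    linarith
  have hF2 := HasFDerivAt.finsleroidFun_sq hg hg' (differentiableAt_bVal y hβ).hasFDerivAt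
    (differentiableAt_quadratic y hA).hasFDerivAt ((qVal_eq y) ▸ hpos)
  simp only [← qVal_eq] at hF2
  rw [HasFDerivAt.pderiv_eq hF2,
    (hasFDerivAt_momentum_base y hg hg' hA hβ n hb hq rfl rfl (hq ▸ hpos) rfl rfl rfl).fderiv,
    metricTensor_mulVec y _ n hb hq, ← hb, ← hq]
  have hwβ : (fun j => β j x) ⬝ᵥ ((g * k * q) • vUp (A x) (fun j => β j x) y + γ) =
      (fun j => β j x) ⬝ᵥ γ := by
    rw [dotProduct_add, dotProduct_smul, dotProduct_vUp y hu]; simp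
  have hvγ : vLow (A x) (fun j => β j x) y ⬝ᵥ γ =
      y.ofLp ⬝ᵥ A x *ᵥ γ - b * ((fun j => β j x) ⬝ᵥ γ) := by
    rw [vLow_eq, sub_dotProduct, smul_dotProduct, dotProduct_mulVec_symm hsx, ← hb, smul_eq_mul]
  have hwv : vLow (A x) (fun j => β j x) y ⬝ᵥ
      ((g * k * q) • vUp (A x) (fun j => β j x) y + γ) =
        g * k * q * q ^ 2 + (y.ofLp ⬝ᵥ A x *ᵥ γ - b * ((fun j => β j x) ⬝ᵥ γ)) := by
    rw [dotProduct_add, dotProduct_smul, vLow_dotProduct_vUp y hsx hdet hu hpos, hvγ, ← hq,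
      smul_eq_mul]
  have hwA : (A x *ᵥ ((g * k * q) • vUp (A x) (fun j => β j x) y + γ)) n =
      g * k * q * ((A x *ᵥ y.ofLp) n - b * β n x) + (A x *ᵥ γ) n := by
    rw [mulVec_add, mulVec_smul, mulVec_vUp y hdet, vLow_eq, ← hb]; rfl
  have hqpos : 0 < q := hq ▸ hpos
  have hB := quadForm_pos hg hg' b hqpos
  rw [hwβ, hwv, hwA, hyAγ, hAγn]
  simp only [_root_.add_apply, _root_.smul_apply, _root_.sub_apply, smul_eq_mul, hβsymm, hbdot]
  rw [← pderiv, ← pderiv]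
  generalize fderiv ℝ (fun z => y.ofLp ⬝ᵥ A z *ᵥ y.ofLp) x y = Sdot
  generalize (fun j => β j x) ⬝ᵥ γ = βγ
  generalize pderiv n (fun z => bVal (fun j => β j z) y) x = bn
  generalize pderiv n (fun z => y.ofLp ⬝ᵥ A z *ᵥ y.ofLp) x = Sn
  generalize fderiv ℝ (fun z => (A z *ᵥ y.ofLp) n) x y = An'
  generalize (A x *ᵥ y.ofLp) n = An
  generalize β n x = βn
  generalize expFactor g b q = E
  obtain ⟨B, hBdef⟩ : ∃ B, B = b ^ 2 + g * q * b + q ^ 2 := ⟨_, rfl⟩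
  rw [← hBdef] at hB ⊢
  field_simp
  -- The terms in k multiplying g/B add up to k q (b² + g q b + q²), so B cancels; what is left, g k
  -- q (g q b_n + a_nj y^j), is balanced by the remaining k-terms.
  rw [hBdef]
  ring

end Local

/-- The tensor `η^i_l η_{mn} + η^i_m η_{ln} + η^i_n η_{lm}`. -/
noncomputable def etaSymm (A : Matrix (Fin N) (Fin N) ℝ) (β : Fin N → ℝ) (y : Coord N) (i l m n : Fin N) : ℝ :=
  etaMix A β y i l * etaLow A β y m n + etaMix A β y i m * etaLow A β y l n +
    etaMix A β y i n * etaLow A β y l m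

/-! ### Third derivatives of the spray coefficients -/

section ThirdDerivative

variable {A : Matrix (Fin N) (Fin N) ℝ} {β : Fin N → ℝ} (y : Coord N)

/-- Shows that v_l is linear in y with coefficients r_lj, so its y-derivative is immediate; likewise
for v^i below. -/
lemma vLow_apply (l : Fin N) : vLow A β y l = bVal (rLow A β l) y := by
  simp only [vLow, bVal, rLow, sub_mul, Finset.sum_sub_distrib, Finset.sum_mul]
  congr 1
  exact Finset.sum_congr rfl fun j _ => by ring

lemma vUp_apply (hdet : A.det ≠ 0) (i : Fin N) : vUp A β y i = bVal (rMix A β i) y := by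
  have h : bVal (rMix A β i) y = ∑ j, (1 : Matrix (Fin N) (Fin N) ℝ) i j * y j -
      bUp A β i * ∑ j, β j * y j := by
    simp only [bVal, rMix_eq hdet, sub_mul, Finset.sum_sub_distrib, Finset.mul_sum, mul_assoc]
  rw [h, vUp, bVal]
  simp [Matrix.one_apply, mul_comm]

lemma hasFDerivAt_vLow (l : Fin N) :
    HasFDerivAt (fun u => vLow A β u l) (coordCLM (rLow A β l)) y := by
  simp only [vLow_apply]
  exact hasFDerivAt_bVal y

lemma hasFDerivAt_vUp (hdet : A.det ≠ 0) (i : Fin N) :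
    HasFDerivAt (fun u => vUp A β u i) (coordCLM (rMix A β i)) y := by
  simp only [vUp_apply _ hdet]
  exact hasFDerivAt_bVal y

lemma hasFDerivAt_qVal (hA : A.IsSymm) (hq : 0 < qVal A β y) :
    HasFDerivAt (fun u => qVal A β u) ((qVal A β y)⁻¹ • coordCLM (vLow A β y)) y := by
  rw [qVal_eq] at hq
  have h := HasFDerivAt.orthNorm (hasFDerivAt_bVal y) (hasFDerivAt_quadratic y hA) hq
  simp only [← qVal_eq] at h
  refine h.congr_fderiv ?_
  ext w
  simp [vLow_eq, coordCLM_apply, sub_dotProduct]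

lemma hasFDerivAt_inv_qVal (hA : A.IsSymm) (hq : 0 < qVal A β y) :
    HasFDerivAt (fun u => (qVal A β u)⁻¹)
      ((-(qVal A β y)⁻¹ ^ 3) • coordCLM (vLow A β y)) y := by
  refine ((hasDerivAt_inv hq.ne').comp_hasFDerivAt y (hasFDerivAt_qVal y hA hq)).congr_fderiv ?_
  rw [smul_smul]
  congr 1
  field_simp

variable {C : Matrix (Fin N) (Fin N) ℝ} {c : ℝ}

lemma pderiv_radial_spray (hA : A.IsSymm) (hdet : A.det ≠ 0) (hq : 0 < qVal A β y)
    (i l : Fin N) :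
    pderiv l (fun u => c * qVal A β u * vUp A β u i + u.ofLp ⬝ᵥ C *ᵥ u.ofLp) y =
      c * ((qVal A β y)⁻¹ * vLow A β y l * vUp A β y i + qVal A β y * rMix A β i l) +
        ((C + Cᵀ) *ᵥ y.ofLp) l := by
  rw [HasFDerivAt.pderiv_eq ((((hasFDerivAt_qVal y hA hq).const_mul c).fun_mul
    (hasFDerivAt_vUp y hdet i)).fun_add (hasFDerivAt_dotProduct_mulVec_self y))]
  simp
  ring

lemma pderiv_pderiv_radial_spray (hA : A.IsSymm) (hdet : A.det ≠ 0) (hq : 0 < qVal A β y)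
    (i l m : Fin N) :
    pderiv m (fun u => c * ((qVal A β u)⁻¹ * vLow A β u l * vUp A β u i +
        qVal A β u * rMix A β i l) + ((C + Cᵀ) *ᵥ u.ofLp) l) y =
      c * ((qVal A β y)⁻¹ * (rLow A β l m * vUp A β y i + vLow A β y l * rMix A β i m +
        vLow A β y m * rMix A β i l) -
          (qVal A β y)⁻¹ ^ 3 * (vLow A β y l * vUp A β y i * vLow A β y m)) + (C + Cᵀ) l m := by
  rw [HasFDerivAt.pderiv_eq ((((((hasFDerivAt_inv_qVal y hA hq).fun_mul
    (hasFDerivAt_vLow y l)).fun_mul (hasFDerivAt_vUp y hdet i)).fun_add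
      ((hasFDerivAt_qVal y hA hq).mul_const (rMix A β i l))).const_mul c).fun_add
        (hasFDerivAt_mulVec (A := C + Cᵀ) y l))]
  simp
  ring

/-- With ∂_n v_l = r_ln, ∂_n v^i = r^i_n and ∂_n q⁻¹ = −v_n/q³, the result has three terms rr/q, six
terms −rvv/q³ and 3 vvvv/q⁵, which is the expansion of the three products of η's over q. -/
lemma pderiv_pderiv_pderiv_radial_spray (hA : A.IsSymm) (hdet : A.det ≠ 0)
    (hq : 0 < qVal A β y) (i l m n : Fin N) :
    pderiv n (fun u => c * ((qVal A β u)⁻¹ * (rLow A β l m * vUp A β u i +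
        vLow A β u l * rMix A β i m + vLow A β u m * rMix A β i l) -
          (qVal A β u)⁻¹ ^ 3 * (vLow A β u l * vUp A β u i * vLow A β u m)) + (C + Cᵀ) l m) y =
      c / qVal A β y * etaSymm A β y i l m n := by
  have hr := hasFDerivAt_inv_qVal y hA hq
  have hl := hasFDerivAt_vLow (A := A) (β := β) y l
  have hm := hasFDerivAt_vLow (A := A) (β := β) y m
  have hi := hasFDerivAt_vUp (β := β) y hdet i
  rw [HasFDerivAt.pderiv_eq ((((hr.fun_mul (((hi.const_mul (rLow A β l m)).fun_add
    (hl.mul_const (rMix A β i m))).fun_add (hm.mul_const (rMix A β i l)))).fun_sub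
      ((hr.pow 3).fun_mul ((hl.fun_mul hi).fun_mul hm))).const_mul c).add_const ((C + Cᵀ) l m))]
  have hs : ∀ j, rLow A β n j = rLow A β j n := fun j => by
    rw [rLow, rLow, hA.apply]; ring
  simp [etaSymm, etaMix, etaLow]
  field_simp
  ring

lemma pderiv₃_radial_spray (hA : A.IsSymm) (hdet : A.det ≠ 0) (hq : 0 < qVal A β y)
    {f : Coord N → ℝ} (i l m n : Fin N) (hf : f =ᶠ[nhds y] fun u =>
      c * qVal A β u * vUp A β u i + u.ofLp ⬝ᵥ C *ᵥ u.ofLp) :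
    pderiv n (pderiv m (pderiv l f)) y =
      c / qVal A β y * etaSymm A β y i l m n := by
  rw [← pderiv_pderiv_pderiv_radial_spray (C := C) y hA hdet hq]
  refine pderiv_congr ?_ n
  -- The derivatives are nested, so each formula must hold on a neighbourhood before the next
  -- derivative is taken.
  filter_upwards [hf.eventually_nhds.eventually_nhds, (eventually_qVal_pos y hq).eventually_nhds]
    with u hu hu'
  rw [← pderiv_pderiv_radial_spray u hA hdet hu'.self_of_nhds]
  refine pderiv_congr ?_ m
  filter_upwards [hu, hu'] with w hw hw'
  rw [← pderiv_radial_spray w hA hdet hw']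
  exact pderiv_congr hw l

end ThirdDerivative

/-! ### The tensors `η` -/

section Eta

variable {A : Matrix (Fin N) (Fin N) ℝ} {β : Fin N → ℝ} (y : Coord N)

lemma etaLow_mulVec (w : Fin N → ℝ) (i : Fin N) :
    ∑ j, etaLow A β y i j * w j = (A *ᵥ w) i - β i * (β ⬝ᵥ w) -
      vLow A β y i * (vLow A β y ⬝ᵥ w) / qVal A β y ^ 2 := by
  simp only [etaLow, rLow, mulVec, dotProduct, Finset.mul_sum, Finset.sum_div,
    ← Finset.sum_sub_distrib]
  exact Finset.sum_congr rfl fun j _ => by ring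

lemma etaMix_mulVec (hdet : A.det ≠ 0) (w : Fin N → ℝ) (i : Fin N) :
    ∑ j, etaMix A β y i j * w j = w i - bUp A β i * (β ⬝ᵥ w) -
      vUp A β y i * (vLow A β y ⬝ᵥ w) / qVal A β y ^ 2 := by
  have h : w i = ((1 : Matrix (Fin N) (Fin N) ℝ) *ᵥ w) i := by rw [one_mulVec]
  rw [h]
  simp only [etaMix, rMix_eq hdet, mulVec, dotProduct, Finset.mul_sum, Finset.sum_div,
    ← Finset.sum_sub_distrib]
  exact Finset.sum_congr rfl fun j _ => by ring

/-- In dimension two the tensor `η_{ij}` vanishes. -/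
lemma etaLow_eq_zero {A : Matrix (Fin 2) (Fin 2) ℝ} {β : Fin 2 → ℝ} (y : Coord 2)
    (hA : A.IsSymm) (hdet : A.det ≠ 0) (hu : ∑ i, ∑ j, A⁻¹ i j * β i * β j = 1)
    (hq : 0 < qVal A β y) (i j : Fin 2) : etaLow A β y i j = 0 := by
  -- The columns are b^i and v^i. Against the rows b_i, v_i they pair to diag(1, q²), hence form a
  -- basis of the plane.
  set W : Matrix (Fin 2) (Fin 2) ℝ := (Matrix.of ![A⁻¹ *ᵥ β, vUp A β y])ᵀ with hW
  have hdetW : W.det ≠ 0 := by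
    have h : Matrix.of ![β, vLow A β y] * W = !![1, 0; 0, qVal A β y ^ 2] := by
      ext a b
      have h2 : (Matrix.of ![β, vLow A β y] * W) a b =
        (![β, vLow A β y] a) ⬝ᵥ (![A⁻¹ *ᵥ β, vUp A β y] b) := rfl
      rw [h2]
      fin_cases a <;> fin_cases b
      · exact dotProduct_bUp hu
      · exact dotProduct_vUp y hu
      · exact vLow_dotProduct_bUp y hA hdet hu
      · exact vLow_dotProduct_vUp y hA hdet hu hq
    intro h0
    have h1 := congrArg det h
    rw [det_mul, h0, det_fin_two_of] at h1
    have := pow_pos hq 2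
    linarith
  have hzero : Matrix.of (etaLow A β y) * W = 0 := by
    ext a b
    have h2 : (Matrix.of (etaLow A β y) * W) a b =
      ∑ j, etaLow A β y a j * (![A⁻¹ *ᵥ β, vUp A β y] b) j := rfl
    rw [h2, etaLow_mulVec]
    fin_cases b
    · change (A *ᵥ A⁻¹ *ᵥ β) a - β a * (β ⬝ᵥ A⁻¹ *ᵥ β) -
        vLow A β y a * (vLow A β y ⬝ᵥ A⁻¹ *ᵥ β) / qVal A β y ^ 2 = 0
      rw [mulVec_inv_mulVec hdet, vLow_dotProduct_bUp y hA hdet hu, dotProduct_bUp hu]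
      simp
    · have h3 := vLow_dotProduct_vUp y hA hdet hu hq
      have h4 := dotProduct_vUp (A := A) y hu
      simp [mulVec_vUp y hdet, h3, h4]
      field_simp
      simp
  have h : Matrix.of (etaLow A β y) = 0 := by
    rw [← mul_one (Matrix.of (etaLow A β y)), ← mul_nonsing_inv W hdetW.isUnit, ← mul_assoc,
      hzero, zero_mul]
  exact congrFun (congrFun h i) j

lemma exists_ne_zero_orthogonal (hN : 3 ≤ N) (c d : Fin N → ℝ) :
    ∃ u : Fin N → ℝ, u ≠ 0 ∧ c ⬝ᵥ u = 0 ∧ d ⬝ᵥ u = 0 := by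
  have h : LinearMap.ker (Matrix.of ![c, d]).mulVecLin ≠ ⊥ :=
    LinearMap.ker_ne_bot_of_finrank_lt (by simp; omega)
  obtain ⟨u, hu, hu0⟩ := Submodule.exists_mem_ne_zero_of_ne_bot h
  have hu' : (Matrix.of ![c, d]) *ᵥ u = 0 := hu
  exact ⟨u, hu0, congrFun hu' 0, congrFun hu' 1⟩

/-- In dimension at least three the symmetrized product of the tensors `η` is not identically
zero. -/
lemma exists_etaSymm_ne_zero (hN : 3 ≤ N) (hpos : ∀ w : Fin N → ℝ, w ≠ 0 → 0 < w ⬝ᵥ A *ᵥ w)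
    (hdet : A.det ≠ 0) :
    ∃ y : Coord N, 0 < qVal A β y ∧ ∃ i l m n, etaSymm A β y i l m n ≠ 0 := by
  -- Taking y = v with b(v) = 0 makes v^i = y^i, and u is then orthogonal to both b^i and v^i, so
  -- both η's act on it as the metric and the identity do.
  obtain ⟨v, hv0, hβv, -⟩ := exists_ne_zero_orthogonal hN β β
  obtain ⟨u, hu0, hβu, hvu⟩ := exists_ne_zero_orthogonal hN β (A *ᵥ v)
  have hb : bVal β (WithLp.toLp 2 v) = 0 := hβv
  refine ⟨WithLp.toLp 2 v, ?_, ?_⟩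
  · rw [qVal_eq, hb]
    exact Real.sqrt_pos.2 (by simpa using hpos v hv0)
  · by_contra! hzero
    simp only [etaSymm] at hzero
    have hvl : vLow A β (WithLp.toLp 2 v) ⬝ᵥ u = 0 := by
      rw [vLow_eq, hb]; simpa using hvu
    have hlow : ∀ m, ∑ n, etaLow A β (WithLp.toLp 2 v) m n * u n = (A *ᵥ u) m := fun m => by
      rw [etaLow_mulVec, hβu, hvl]; simp
    have hmix : ∀ i, ∑ n, etaMix A β (WithLp.toLp 2 v) i n * u n = u i := fun m => by
      rw [etaMix_mulVec _ hdet, hβu, hvl]; simp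
    generalize etaLow A β (WithLp.toLp 2 v) = L at *
    generalize etaMix A β (WithLp.toLp 2 v) = X at *
    -- Contract the vanishing tensor with u in n, then m, then l; each of the three products finally
    -- contributes u^i a(u,u).
    have h1 : ∀ i l m, X i l * (A *ᵥ u) m + X i m * (A *ᵥ u) l + u i * L l m = 0 := by
      intro i l m
      rw [← hlow, ← hlow, ← hmix, Finset.mul_sum, Finset.mul_sum, Finset.sum_mul,
        ← Finset.sum_add_distrib, ← Finset.sum_add_distrib]
      refine Finset.sum_eq_zero fun n _ => ?_
      linear_combination u n * hzero i l m n
    have h2 : ∀ i l, X i l * (u ⬝ᵥ A *ᵥ u) + u i * (A *ᵥ u) l + u i * (A *ᵥ u) l = 0 := by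
      intro i l
      nth_rw 1 [← hmix i]
      rw [← hlow l, dotProduct, Finset.mul_sum, Finset.sum_mul, Finset.mul_sum,
        ← Finset.sum_add_distrib, ← Finset.sum_add_distrib]
      refine Finset.sum_eq_zero fun m _ => ?_
      have := h1 i l m
      rw [← hlow l] at this
      linear_combination u m * this
    have h3 : ∀ i, 3 * (u i * (u ⬝ᵥ A *ᵥ u)) = 0 := by
      intro i
      have e : ∑ l, (X i l * u l * (u ⬝ᵥ A *ᵥ u) + 2 * u i * (u l * (A *ᵥ u) l)) = 0 :=
        Finset.sum_eq_zero fun l _ => by linear_combination u l * h2 i l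
      rw [Finset.sum_add_distrib, ← Finset.sum_mul, ← Finset.mul_sum, hmix] at e
      have e2 : ∑ l, u l * (A *ᵥ u) l = u ⬝ᵥ A *ᵥ u := rfl
      rw [e2] at e
      linear_combination e
    apply hu0
    ext i
    have := h3 i
    simpa [(hpos u hu0).ne'] using this

end Eta

/-! ### Passing to charts -/

section Charts

variable {M : Type*} [TopologicalSpace M] [ChartedSpace (Coord N) M]
  {e : OpenPartialHomeomorph M (Coord N)} (x y : Coord N)

lemma tangentOf_eq_sum :
    tangentOf e x y = ∑ i, y i • tangentOf e x (basisVec i) := by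
  have hy : y = ∑ m, y m • basisVec m := by
    ext i
    simp [basisVec_apply]
  unfold tangentOf
  conv_lhs => rw [hy]
  exact (map_sum (mfderiv (𝓡 N) (𝓡 N) e.symm x) (fun i => y i • basisVec i) Finset.univ).trans
    (Finset.sum_congr rfl fun i _ => map_smul (mfderiv (𝓡 N) (𝓡 N) e.symm x) (y i) (basisVec i))

lemma apply_tangentOf (b : OneForm N M) :
    b (e.symm x) (tangentOf e x y) = bVal (fun j => formComp b e j x) y := by
  rw [tangentOf_eq_sum, map_sum]
  simp only [map_smul, smul_eq_mul, bVal, formComp, mul_comm]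

lemma mdifferentiable_of_mem_charts (he : e ∈ charts N M) : e.MDifferentiable (𝓡 N) (𝓡 N) :=
  ⟨fun p hp => ((contMDiffOn_of_mem_maximalAtlas he).mdifferentiableOn (by simp)) p hp,
    fun p hp => ((contMDiffOn_symm_of_mem_maximalAtlas he).mdifferentiableOn (by simp)) p hp⟩

variable {x} in
lemma tangentOf_injective (he : e ∈ charts N M) (hx : x ∈ e.target) :
    Function.Injective (tangentOf e x) :=
  (mdifferentiable_of_mem_charts he).symm.mfderiv_injective hx

variable [IsManifold (𝓡 N) ∞ M] (a : Metric N M)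

lemma inner_tangentOf :
    a.inner (e.symm x) (tangentOf e x y) (tangentOf e x y) =
      y.ofLp ⬝ᵥ metricComp a e x *ᵥ y.ofLp := by
  conv_lhs => rw [tangentOf_eq_sum]
  simp only [map_sum, map_smul, FunLike.coe_sum, Finset.sum_apply, _root_.smul_apply,
    smul_eq_mul, dotProduct, mulVec, metricComp, Matrix.of_apply, Finset.mul_sum]
  rw [Finset.sum_comm]
  refine Finset.sum_congr rfl fun i _ => Finset.sum_congr rfl fun j _ => ?_
  ring

lemma qScalar_tangentOf (b : OneForm N M) :
    qScalar a b (e.symm x) (tangentOf e x y) =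
      qVal (metricComp a e x) (fun j => formComp b e j x) y := by
  rw [qScalar, inner_tangentOf, apply_tangentOf, qVal_eq]

lemma localFun_finsleroidK (b : OneForm N M) (g : ℝ) :
    localFun (finsleroidK a b g) e x = fun y =>
      finsleroidFun g (bVal (fun j => formComp b e j x) y)
        (qVal (metricComp a e x) (fun j => formComp b e j x) y) := by
  ext y
  rw [localFun, finsleroidK, apply_tangentOf, qScalar_tangentOf]

lemma metricComp_isSymm : (metricComp a e x).IsSymm := by
  ext i j
  exact a.symm _ _ _

variable {x} (he : e ∈ charts N M) (hx : x ∈ e.target)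
include he hx

/-- Positivity transfers from the manifold because the differential of the inverse chart is
injective. -/
lemma metricComp_pos (w : Fin N → ℝ) (hw : w ≠ 0) : 0 < w ⬝ᵥ metricComp a e x *ᵥ w := by
  have h := inner_tangentOf (e := e) x (WithLp.toLp 2 w) a
  rw [← h]
  refine a.pos _ _ fun h0 => hw ?_
  have h1 : tangentOf e x (WithLp.toLp 2 w) = tangentOf e x 0 := by
    rw [h0, tangentOf_eq_sum x 0]; simp
  simpa using tangentOf_injective he hx h1

lemma det_metricComp_ne_zero : (metricComp a e x).det ≠ 0 := by
  intro h0
  obtain ⟨w, hw, hw0⟩ := Matrix.exists_mulVec_eq_zero_iff.2 h0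
  have := metricComp_pos a he hx w hw
  simp [hw0] at this

/-- The coordinate fields are the images of constant fields on ℝ^N under the tangent map of the
inverse chart, which is smooth. -/
lemma contMDiffAt_tangentOf (v : Coord N) :
    ContMDiffAt (𝓡 N) ((𝓡 N).prod (𝓡 N)) ∞
      (fun z => TotalSpace.mk' (Coord N) (E := fun p : M => TangentSpace (𝓡 N) p)
        (e.symm z) (tangentOf e z v)) x := by
  have h1 := (contMDiffOn_symm_of_mem_maximalAtlas he).contMDiffOn_tangentMapWithin
    (m := ∞) (by simp) e.open_target.uniqueMDiffOn
  have h2 : ContMDiff (𝓡 N) (𝓡 N).tangent ∞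
      (fun z => (⟨z, v⟩ : TangentBundle (𝓡 N) (Coord N))) :=
    contMDiff_vectorSpace_iff_contDiff.2 contDiff_const
  have h3 := (h1.contMDiffAt ((e.open_target.preimage
    (FiberBundle.continuous_proj _ _)).mem_nhds (x := ⟨x, v⟩) hx)).comp x (h2 x)
  refine h3.congr_of_eventuallyEq ?_
  filter_upwards [e.open_target.mem_nhds hx] with z hz
  simp only [Function.comp_apply, tangentMapWithin, tangentOf]
  rw [mfderivWithin_of_isOpen e.open_target hz]

lemma contDiffAt_metricComp (i j : Fin N) : ContDiffAt ℝ ∞ (fun z => metricComp a e z i j) x := by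
  rw [← contMDiffAt_iff_contDiffAt]
  have hs : ContMDiffAt (𝓡 N) (𝓡 N) ∞ e.symm x :=
    (contMDiffOn_symm_of_mem_maximalAtlas he).contMDiffAt (e.open_target.mem_nhds hx)
  have h := ContMDiffAt.clm_bundle_apply₂ (F₁ := Coord N) (F₂ := Coord N) (F₃ := ℝ)
    (E₃ := Trivial M ℝ) ((a.contMDiff (e.symm x)).comp x hs)
    (contMDiffAt_tangentOf he hx (basisVec i)) (contMDiffAt_tangentOf he hx (basisVec j))
  -- The target bundle is trivial, so the fibre component of this smooth section is the function
  -- itself.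
  rw [Bundle.contMDiffAt_totalSpace] at h
  exact h.2

lemma contDiffAt_formComp {b : OneForm N M} (hb : SmoothOneForm b) (i : Fin N) :
    ContDiffAt ℝ ∞ (formComp b e i) x := by
  rw [← contMDiffAt_iff_contDiffAt]
  have hs : ContMDiffAt (𝓡 N) (𝓡 N) ∞ e.symm x :=
    (contMDiffOn_symm_of_mem_maximalAtlas he).contMDiffAt (e.open_target.mem_nhds hx)
  have h := ContMDiffAt.clm_bundle_apply (F₁ := Coord N) (F₂ := ℝ) (E₂ := Trivial M ℝ)
    ((hb (e.symm x)).comp x hs) (contMDiffAt_tangentOf he hx (basisVec i))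
  rw [Bundle.contMDiffAt_totalSpace] at h
  exact h.2

lemma contDiffAt_localFun_finsleroidK {b : OneForm N M} (hb : SmoothOneForm b) {g : ℝ}
    (hg : -2 < g) (hg' : g < 2)
    (hq : 0 < qVal (metricComp a e x) (fun j => formComp b e j x) y) :
    ContDiffAt ℝ ∞ (fun z : Coord N × Coord N => localFun (finsleroidK a b g) e z.1 z.2)
      (x, y) := by
  simp only [localFun_finsleroidK]
  have hcoord : ∀ i, ContDiffAt ℝ ∞ (fun z : Coord N × Coord N => z.2 i) (x, y) := fun i =>
    (EuclideanSpace.proj (𝕜 := ℝ) i).contDiff.contDiffAt.comp (x, y) contDiffAt_snd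
  have hβ : ∀ i, ContDiffAt ℝ ∞ (fun z : Coord N × Coord N => formComp b e i z.1) (x, y) :=
    fun i => (contDiffAt_formComp he hx hb i).comp (x, y) contDiffAt_fst
  have hA : ∀ i j, ContDiffAt ℝ ∞ (fun z : Coord N × Coord N => metricComp a e z.1 i j) (x, y) :=
    fun i j => (contDiffAt_metricComp a he hx i j).comp (x, y) contDiffAt_fst
  refine ContDiffAt.finsleroidFun hg hg' ?_ ?_ hq
  · exact ContDiffAt.sum fun i _ => (hβ i).mul (hcoord i)
  · exact (ContDiffAt.sum fun i _ => ContDiffAt.sum fun j _ =>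
      (((hA i j).sub ((hβ i).mul (hβ j))).mul (hcoord i)).mul (hcoord j)).sqrt
        (Real.sqrt_pos.1 hq).ne'

end Charts

/-! ### The spray of the Finsleroid metric function in charts -/

section Spray

variable {M : Type*} [TopologicalSpace M] [ChartedSpace (Coord N) M]
  [IsManifold (𝓡 N) ∞ M] (a : Metric N M) {b : OneForm N M} {k : M → ℝ} {g : ℝ}
  {e : OpenPartialHomeomorph M (Coord N)} (he : e ∈ charts N M) {x : Coord N}
  (hx : x ∈ e.target) (y : Coord N)
include he hx

lemma spray_finsleroidK (hb : SmoothOneForm b) (hunit : HasUnitLength a b) (hg : -2 < g)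
    (hg' : g < 2) (hk : NablaCondition a b k)
    (hq : 0 < qVal (metricComp a e x) (fun j => formComp b e j x) y) (i : Fin N) :
    spray (localFun (finsleroidK a b g) e) i x y =
      landsbergSpray (metricComp a e) (formComp b e) (g * k (e.symm x)) i x y :=
  spray_eq_landsbergSpray y hg hg' (.of_forall fun z => metricComp_isSymm z a)
    (det_metricComp_ne_zero a he hx) (hunit e he x hx)
    (fun i j => (contDiffAt_metricComp a he hx i j).differentiableAt (by simp))
    (fun i => (contDiffAt_formComp he hx hb i).differentiableAt (by simp))
    (hk e he x hx) hq (fun z => localFun_finsleroidK z a b g) i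

lemma spray3_finsleroidK (hb : SmoothOneForm b) (hunit : HasUnitLength a b) (hg : -2 < g)
    (hg' : g < 2) (hk : NablaCondition a b k)
    (hq : 0 < qVal (metricComp a e x) (fun j => formComp b e j x) y) (i l m n : Fin N) :
    spray3 (localFun (finsleroidK a b g) e) i l m n x y =
      g * k (e.symm x) / qVal (metricComp a e x) (fun j => formComp b e j x) y *
        etaSymm (metricComp a e x) (fun j => formComp b e j x) y i l m n := by
  -- At fixed x the Riemannian part is the quadratic form in y whose matrix is formed by the
  -- Christoffel symbols.
  refine pderiv₃_radial_spray (C := Matrix.of fun n m => christoffel (metricComp a e) i n m x) y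
    (metricComp_isSymm x a) (det_metricComp_ne_zero a he hx) hq i l m n ?_
  filter_upwards [eventually_qVal_pos y hq] with w hw
  rw [spray_finsleroidK a he hx w hb hunit hg hg' hk hw, landsbergSpray]
  congr 1
  simp only [dotProduct, mulVec, Matrix.of_apply, Finset.mul_sum]
  exact Finset.sum_congr rfl fun n _ => Finset.sum_congr rfl fun m _ => by ring

end Spray

end Finsleroid

/-! ### Assembly of the four assertions -/

theorem proposition2 {N : ℕ} (hN : 2 ≤ N)
    {M : Type*} [TopologicalSpace M] [ChartedSpace (Finsleroid.Coord N) M]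
    [IsManifold (𝓡 N) ∞ M]
    (a : Finsleroid.Metric N M)
    (b : Finsleroid.OneForm N M) (hb : Finsleroid.SmoothOneForm b)
    (hunit : Finsleroid.HasUnitLength a b)
    (g : ℝ) (hg : -2 < g) (hg' : g < 2)
    (k : M → ℝ) (hk : Finsleroid.NablaCondition a b k) :
    (∀ e ∈ Finsleroid.charts N M, ∀ x ∈ e.target, ∀ y : Finsleroid.Coord N,
      Finsleroid.tangentOf e x y ∈ Finsleroid.regularDomain a b (e.symm x) →
      -- the local expression of the metric function is smooth, its metric tensor invertible
      (ContDiffAt ℝ ∞ (fun z : Finsleroid.Coord N × Finsleroid.Coord N =>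
          Finsleroid.localFun (Finsleroid.finsleroidK a b g) e z.1 z.2) (x, y) ∧
        (Finsleroid.fundTensor
          (Finsleroid.localFun (Finsleroid.finsleroidK a b g) e) x y).det ≠ 0) ∧
      -- the geodesic spray coefficients are of Landsberg type, with `c = g k`
      (∀ i : Fin N,
        Finsleroid.spray (Finsleroid.localFun (Finsleroid.finsleroidK a b g) e) i x y =
          Finsleroid.landsbergSpray (Finsleroid.metricComp a e) (Finsleroid.formComp b e)
            (g * k (e.symm x)) i x y) ∧
      -- the coefficients `G^i_{kmn}`
      (∀ i l m n : Fin N,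
        let A := Finsleroid.metricComp a e x
        let β := fun j => Finsleroid.formComp b e j x
        Finsleroid.spray3 (Finsleroid.localFun (Finsleroid.finsleroidK a b g) e) i l m n x y =
          g * k (e.symm x) / Finsleroid.qVal A β y *
            (Finsleroid.etaMix A β y i l * Finsleroid.etaLow A β y m n
              + Finsleroid.etaMix A β y i m * Finsleroid.etaLow A β y l n
              + Finsleroid.etaMix A β y i n * Finsleroid.etaLow A β y l m))) ∧
    -- the Berwald case
    (3 ≤ N →
      (Finsleroid.IsBerwaldOn (Finsleroid.finsleroidK a b g) (Finsleroid.regularDomain a b) ↔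
        g = 0 ∨ ∀ p : M, k p = 0)) ∧
    (N = 2 →
      Finsleroid.IsBerwaldOn (Finsleroid.finsleroidK a b g) (Finsleroid.regularDomain a b)) := by
  have hcurv : ∀ e ∈ Finsleroid.charts N M, ∀ x ∈ e.target, ∀ y : Finsleroid.Coord N,
      0 < Finsleroid.qVal (Finsleroid.metricComp a e x)
        (fun j => Finsleroid.formComp b e j x) y → ∀ i l m n : Fin N,
      Finsleroid.spray3 (Finsleroid.localFun (Finsleroid.finsleroidK a b g) e) i l m n x y =
        g * k (e.symm x) / Finsleroid.qVal (Finsleroid.metricComp a e x)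
          (fun j => Finsleroid.formComp b e j x) y * Finsleroid.etaSymm
            (Finsleroid.metricComp a e x) (fun j => Finsleroid.formComp b e j x) y i l m n :=
    fun e he x hx y hq => Finsleroid.spray3_finsleroidK a he hx y hb hunit hg hg' hk hq
  have hdom : ∀ (e : OpenPartialHomeomorph M (Finsleroid.Coord N)) (x y : Finsleroid.Coord N),
      Finsleroid.tangentOf e x y ∈ Finsleroid.regularDomain a b (e.symm x) ↔
        0 < Finsleroid.qVal (Finsleroid.metricComp a e x)
          (fun j => Finsleroid.formComp b e j x) y := fun e x y => by
    rw [← Finsleroid.qScalar_tangentOf]; rfl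
  refine ⟨fun e he x hx y hy => ?_, fun hN3 => ⟨fun hB => ?_, fun h => ?_⟩, fun hN2 => ?_⟩
  · have hq := (hdom e x y).1 hy
    refine ⟨⟨Finsleroid.contDiffAt_localFun_finsleroidK y a he hx hb hg hg' hq, ?_⟩,
      Finsleroid.spray_finsleroidK a he hx y hb hunit hg hg' hk hq, hcurv e he x hx y hq⟩
    rw [Finsleroid.fundTensor_eq y hg hg' (Finsleroid.metricComp_isSymm x a) hq
      (Finsleroid.localFun_finsleroidK x a b g)]
    exact Finsleroid.det_metricTensor_ne_zero y hg hg' (Finsleroid.metricComp_isSymm x a)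
      (Finsleroid.det_metricComp_ne_zero a he hx) (hunit e he x hx) hq
  · by_contra! h0
    obtain ⟨hg0, p, hp⟩ := h0
    -- Where g k(p) ≠ 0, the preferred chart at p and a direction y with non-zero symmetrised
    -- η-product contradict the Berwald property.
    have he : chartAt (Finsleroid.Coord N) p ∈ Finsleroid.charts N M :=
      IsManifold.chart_mem_maximalAtlas p
    have hps := mem_chart_source (Finsleroid.Coord N) p
    have hx := (chartAt (Finsleroid.Coord N) p).map_source hps
    obtain ⟨y, hq, i, l, m, n, hne⟩ := Finsleroid.exists_etaSymm_ne_zero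
      (β := fun j => Finsleroid.formComp b (chartAt (Finsleroid.Coord N) p) j
        (chartAt (Finsleroid.Coord N) p p)) hN3
      (Finsleroid.metricComp_pos a he hx) (Finsleroid.det_metricComp_ne_zero a he hx)
    have h := hB _ he _ hx y ((hdom _ _ y).2 hq) i l m n
    rw [hcurv _ he _ hx y hq, OpenPartialHomeomorph.left_inv _ hps] at h
    exact mul_ne_zero (div_ne_zero (mul_ne_zero hg0 hp) hq.ne') hne h
  · intro e he x hx y hy i l m n
    rw [hcurv e he x hx y ((hdom e x y).1 hy)]
    rcases h with h | h <;> simp [h]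
  · subst hN2
    intro e he x hx y hy i l m n
    have hq := (hdom e x y).1 hy
    rw [hcurv e he x hx y hq]
    simp [Finsleroid.etaSymm, Finsleroid.etaLow_eq_zero y (Finsleroid.metricComp_isSymm x a)
      (Finsleroid.det_metricComp_ne_zero a he hx) (hunit e he x hx) hq]
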